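/- Let $n$ denote a standard complex Gaussian variable ($n=n^I+jn^Q$ with $n^I,n^Q\sim\mathcal N(0,1/2)$ independent). For a finite constellation $\mathcal C\subset\mathbb C$ let $x$ be uniformly distributed on $\mathcal C$, independent of $n$, and for $\gamma\ge 0$ let $I_x(\gamma)=I(x;\sqrt{\gamma}\,x+n)$ be the input-output mutual information of the scalar complex Gaussian channel with SNR $\gamma$. For $\zeta\ge0$ put $I_x^{\log}(\zeta)=I_x(e^{\zeta}-1)$, the mutual information as a function of the log-SNR $\zeta=\log(1+\gamma)$. Let $\bar\zeta_0\ge0$ be the minimal $\zeta_0\ge0$ such that $I_x^{\log}$ is concave on $[\zeta_0,\infty)$, and $\bar\gamma_0=e^{\bar\zeta_0}-1$. Let $d_{\min}$ be the minimum distance between distinct points of $\mathcal C$. Theorem. Let $M\ge2$, and let $\mathcal C$ be either the $M$-PAM constellation $\{(k-\frac{M-1}{2})d : 0\le k<M\}$ or the square $M^2$-QAM constellation $\{(k-\frac{M-1}{2})d+j\,(l-\frac{M-1}{2})d : 0\le k,l<M\}$, with the spacing $d>0$ such that $\mathbb E|x|^2=1$. Then the minimum $\bar\zeta_0$ exists,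 and $$\left(\frac{d_{\min}}{2}\right)^{2}\bar\gamma_0\le 1 .$$ In particular, $I_x^{\log}$ is concave on the interval of all $\zeta=\log(1+\gamma)$ with $(d_{\min}/2)^2\gamma\ge1$. -/

import Mathlib

open MeasureTheory ProbabilityTheory InformationTheory

noncomputable section

/-- The law of a standard complex Gaussian variable `n = nI + j nQ`, where `nI` and `nQ` are
independent real Gaussian variables of mean `0` and variance `1/2`. -/
def stdComplexGaussian : Measure ℂ :=
  ((gaussianReal 0 (1 / 2)).prod (gaussianReal 0 (1 / 2))).map
    (fun p : ℝ × ℝ => (⟨p.1, p.2⟩ : ℂ))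

/-- The joint law of the input `x` and the output `y = √γ x + n` of the scalar complex Gaussian
channel with SNR `γ`, where `x` has law `P` and the standard complex Gaussian noise `n` is
independent of `x`. -/
def channelJoint (P : Measure ℂ) (γ : ℝ) : Measure (ℂ × ℂ) :=
  (P.prod stdComplexGaussian).map (fun p : ℂ × ℂ => (p.1, (Real.sqrt γ : ℂ) * p.1 + p.2))

/-- The mutual information `I(x ; y)` (in nats) of a pair `(x, y)` with law `J`: the
Kullback-Leibler divergence of the joint law with respect to the product of the marginals, in
`[0, ∞]`. -/
def mutualInfo (J : Measure (ℂ × ℂ)) : ENNReal :=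
  klDiv J ((J.map Prod.fst).prod (J.map Prod.snd))

lemma klDiv_ne_top_of_le_smul {α : Type*} [MeasurableSpace α] (μ ν : Measure α)
    [IsFiniteMeasure μ] [IsFiniteMeasure ν] (c : NNReal) (h : μ ≤ c • ν) : klDiv μ ν ≠ ⊤ := by
  have hac : μ ≪ ν := (Measure.absolutelyContinuous_of_le h).trans
    (Measure.smul_absolutelyContinuous (c := c))
  have hle : ∀ᵐ x ∂ν, μ.rnDeriv ν x ≤ c := by
    have : μ.rnDeriv ν ≤ᵐ[ν] fun _ => (c : ENNReal) := by
      refine ae_le_of_forall_setLIntegral_le_of_sigmaFinite (Measure.measurable_rnDeriv μ ν) ?_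
      intro s _ _
      rw [lintegral_const, Measure.restrict_apply_univ]
      exact (Measure.setLIntegral_rnDeriv_le s).trans (by simpa using h s)
    exact this
  rw [klDiv_eq_lintegral_klFun_of_ac hac]
  obtain ⟨B, hB⟩ := (isCompact_Icc (a := (0 : ℝ)) (b := c)).exists_bound_of_continuousOn
    continuous_klFun.continuousOn
  refine ne_of_lt (lt_of_le_of_lt (lintegral_mono_ae (g := fun _ => ENNReal.ofReal B) ?_) ?_)
  · filter_upwards [hle] with x hx
    refine ENNReal.ofReal_le_ofReal ((le_abs_self _).trans (hB _ ⟨ENNReal.toReal_nonneg, ?_⟩))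
    simpa using ENNReal.toReal_mono ENNReal.coe_ne_top hx
  · rw [lintegral_const]
    exact ENNReal.mul_lt_top ENNReal.ofReal_lt_top (measure_lt_top ν _)

lemma measurable_complex_mk : Measurable (fun p : ℝ × ℝ => (⟨p.1, p.2⟩ : ℂ)) :=
  Complex.measurableEquivRealProd.symm.measurable

instance isProbabilityMeasure_stdComplexGaussian :
    IsProbabilityMeasure stdComplexGaussian :=
  Measure.isProbabilityMeasure_map measurable_complex_mk.aemeasurable

lemma uniformOn_coe_finset (C : Finset ℂ) :
    uniformOn (C : Set ℂ) = (C.card : ENNReal)⁻¹ • ∑ x ∈ C, Measure.dirac x := by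
  classical
  ext s hs
  rw [uniformOn, cond_apply C.measurableSet]
  simp only [Measure.smul_apply, Measure.coe_finsetSum, Finset.sum_apply,
    Measure.dirac_apply' _ hs, Measure.count_apply_finset, smul_eq_mul]
  congr 1
  have : (C : Set ℂ) ∩ s = ((C.filter (· ∈ s) : Finset ℂ) : Set ℂ) := by
    ext; simp
  rw [this, Measure.count_apply_finset]
  simp [Set.indicator_apply]

theorem mutualInfo_channelJoint_ne_top (C : Finset ℂ) (γ : ℝ) :
    mutualInfo (channelJoint (uniformOn (C : Set ℂ)) γ) ≠ ⊤ := by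
  rcases C.eq_empty_or_nonempty with rfl | hC
  · simp [mutualInfo, channelJoint]
  have hcard : (C.card : ENNReal) ≠ 0 := by simpa using hC.ne_empty
  have : IsProbabilityMeasure (uniformOn (C : Set ℂ)) :=
    isProbabilityMeasure_uniformOn C.finite_toSet hC
  have hT : Measurable (fun p : ℂ × ℂ => (p.1, (Real.sqrt γ : ℂ) * p.1 + p.2)) := by fun_prop
  have : IsProbabilityMeasure (channelJoint (uniformOn (C : Set ℂ)) γ) :=
    Measure.isProbabilityMeasure_map hT.aemeasurable
  have hfst : (channelJoint (uniformOn (C : Set ℂ)) γ).map Prod.fst = uniformOn (C : Set ℂ) := by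
    rw [channelJoint, Measure.map_map measurable_fst hT]
    exact measurePreserving_fst.map_eq
  have hlin (f : ℂ → ENNReal) :
      ∫⁻ x, f x ∂(uniformOn (C : Set ℂ)) = (C.card : ENNReal)⁻¹ * ∑ x ∈ C, f x := by
    rw [uniformOn_coe_finset, lintegral_smul_measure, lintegral_finsetSum_measure]
    simp [lintegral_dirac]
  have hJ {A : Set (ℂ × ℂ)} (hA : MeasurableSet A) :
      channelJoint (uniformOn (C : Set ℂ)) γ A = (C.card : ENNReal)⁻¹ *
        ∑ x ∈ C, stdComplexGaussian {n | (x, (Real.sqrt γ : ℂ) * x + n) ∈ A} := by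
    rw [channelJoint, Measure.map_apply hT hA, Measure.prod_apply (hT hA), hlin]
    rfl
  refine klDiv_ne_top_of_le_smul _ _ (C.card : NNReal) (Measure.le_iff.2 fun A hA => ?_)
  have hQ : ((channelJoint (uniformOn (C : Set ℂ)) γ).map Prod.fst).prod
      ((channelJoint (uniformOn (C : Set ℂ)) γ).map Prod.snd) A = (C.card : ENNReal)⁻¹ *
        ∑ x ∈ C, channelJoint (uniformOn (C : Set ℂ)) γ {p | (x, p.2) ∈ A} := by
    rw [Measure.prod_apply hA, hfst, hlin]
    congr 1
    refine Finset.sum_congr rfl fun x _ => ?_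
    rw [Measure.map_apply measurable_snd (measurable_prodMk_left hA)]
    rfl
  rw [Measure.smul_apply, hQ, hJ hA, ENNReal.smul_def, smul_eq_mul,
    ENNReal.coe_natCast]
  rw [← mul_assoc, ENNReal.mul_inv_cancel hcard (by simp), one_mul, Finset.mul_sum]
  refine Finset.sum_le_sum fun x hx => ?_
  have hx2 : Measurable (fun p : ℂ × ℂ => (x, p.2)) := by fun_prop
  rw [hJ (A := {p | (x, p.2) ∈ A}) (hx2 hA)]
  gcongr
  exact Finset.single_le_sum
    (f := fun x' => stdComplexGaussian {n | (x, (Real.sqrt γ : ℂ) * x' + n) ∈ A})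
    (fun _ _ => zero_le) hx

/-- `I_x(γ) = I(x ; √γ x + n)` for an input `x` uniformly distributed on the finite constellation
`C`. It is always finite, see `mutualInfo_channelJoint_ne_top`. -/
def inputOutputInfo (C : Finset ℂ) (γ : ℝ) : ℝ :=
  (mutualInfo (channelJoint (uniformOn (C : Set ℂ)) γ)).toReal

/-- The mutual information as a function of the log-SNR `ζ = log (1 + γ)`. -/
def infoLog (C : Finset ℂ) (ζ : ℝ) : ℝ :=
  inputOutputInfo C (Real.exp ζ - 1)

/-- The set of all `ζ₀ ≥ 0` such that the mutual information is a concave function of the log-SNR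
on `[ζ₀, ∞)`. -/
def concaveThresholds (C : Finset ℂ) : Set ℝ :=
  {ζ₀ | 0 ≤ ζ₀ ∧ ConcaveOn ℝ (Set.Ici ζ₀) (infoLog C)}

/-- The high log-SNR threshold: the minimal element of `concaveThresholds C`, written as an
infimum (a junk value unless it is known that there is a least element). -/
def zetaBar (C : Finset ℂ) : ℝ := sInf (concaveThresholds C)

/-- The high SNR threshold, the SNR that corresponds to the log-SNR `zetaBar C`. -/
def gammaBar (C : Finset ℂ) : ℝ := Real.exp (zetaBar C) - 1

/-- The average power `E |x|²` of an input `x` uniformly distributed on `C`. -/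
def avgPower (C : Finset ℂ) : ℝ := ∫ x, ‖x‖ ^ 2 ∂(uniformOn (C : Set ℂ))

/-- The `M`-PAM constellation with spacing `d`: the `M` real points `(k - (M - 1) / 2) d`,
`0 ≤ k < M`, centred at the origin. -/
def pam (M : ℕ) (d : ℝ) : Finset ℂ :=
  (Finset.range M).image (fun k : ℕ => (((k - (M - 1) / 2) * d : ℝ) : ℂ))

/-- The square `M²`-QAM constellation with spacing `d`: two `M`-PAM constellations in quadrature. -/
def squareQAM (M : ℕ) (d : ℝ) : Finset ℂ :=
  (pam M d ×ˢ pam M d).image (fun p : ℂ × ℂ => p.1 + Complex.I * p.2)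

/-- The minimum distance between two different points of a constellation. -/
def minDist (C : Finset ℂ) : ℝ := (C : Set ℂ).infsep

end

/-! Put `s = 2γ`. The output density of PAM depends on one real coordinate only, and that of square
QAM is a product of two such densities. In both cases the information is therefore, up to a
nonnegative factor and an additive constant, `γ P - H(2γ)`, where `P` is the sum of the squared PAM
points and `H` is `gaussianEntropy` (`inputOutputInfo_pam`, `inputOutputInfo_squareQAM`).

Heat flow gives `H' = ½ meanSqCondMean` (`hasDerivAt_gaussianEntropy`, the I-MMSE relation), and the
derivative of `meanSqCondMean` is the mean of the squared conditional variance `V²`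
(`hasDerivAt_meanSqCondMean`). With means unnormalised, the second derivative in `ζ` of `γ P -
H(2γ)` is `e^ζ (E V - 2 e^ζ E V²)`. Since `2 e^ζ ≥ s`, concavity follows from `E V ≤ s E V²`, which
is proved for `s d² ≥ 8`, that is `(d/2)² γ ≥ 1`.

At a fixed output the posterior weights `g k` are Gaussian values along a lattice, hence strongly
log-concave: `g k * g (k + 2) ≤ e⁻⁸ g (k + 1)²` with `e⁻⁸ ≤ 54⁻²`. So at most two adjacent weights
are comparable. Let `p` be `pairWeight` and `q` be `p` divided by the sum of the two weights. The
total weight `W` satisfies `W V ≤ (27/25) Σ p` (`sum_mul_indexVar_le`) and `W V² ≥ Σ p (54 q -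
53/50) / 50` (`le_sum_mul_indexVar_sq`), with `V` in units of the index. Both sums run over adjacent
pairs, and around its midpoint every pair yields the same functions `e^{-v²/2} / cosh (h v)` and
`e^{-v²/2} / cosh³ (h v)`, where `h = √s d / 2`. The claim is thus reduced to comparing two
one-dimensional integrals, done by one integration by parts and `tanh u ≤ u` for `u ≥ 0`
(`integral_exp_neg_sq_div_cosh_le`). -/

noncomputable section

/-! ### Variance bounds for strongly log-concave weights on the integers. -/

section LogConcave

variable {g : ℕ → ℝ}

/-- Half the harmonic mean of the adjacent weights `g k` and `g (k + 1)`. -/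
def pairWeight (g : ℕ → ℝ) (k : ℕ) : ℝ := g k * g (k + 1) / (g k + g (k + 1))

/-- The variance of the index under the weights `g 0, …, g (n - 1)`. -/
def indexVar (g : ℕ → ℝ) (n : ℕ) : ℝ :=
  (∑ k ∈ Finset.range n, (k : ℝ) ^ 2 * g k) / (∑ k ∈ Finset.range n, g k) -
    ((∑ k ∈ Finset.range n, (k : ℝ) * g k) / (∑ k ∈ Finset.range n, g k)) ^ 2

/-- Lagrange's identity; each unordered pair occurs once, so no factor 1/2 appears. -/
lemma sum_mul_sum_sub_sq (g : ℕ → ℝ) (n : ℕ) :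
    (∑ k ∈ Finset.range n, g k) * (∑ k ∈ Finset.range n, (k : ℝ) ^ 2 * g k) -
      (∑ k ∈ Finset.range n, (k : ℝ) * g k) ^ 2 =
    ∑ j ∈ Finset.range n, ∑ i ∈ Finset.range j, g i * g j * ((j : ℝ) - i) ^ 2 := by
  induction n with
  | zero => simp
  | succ n ih =>
    simp only [Finset.sum_range_succ]
    rw [← ih]
    have : ∑ i ∈ Finset.range n, g i * g n * ((n : ℝ) - i) ^ 2 =
        g n * (∑ k ∈ Finset.range n, (k : ℝ) ^ 2 * g k)
        - 2 * n * g n * (∑ k ∈ Finset.range n, (k : ℝ) * g k)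
        + n ^ 2 * g n * (∑ k ∈ Finset.range n, g k) := by
      simp only [Finset.mul_sum]
      rw [← Finset.sum_sub_distrib, ← Finset.sum_add_distrib]
      exact Finset.sum_congr rfl fun i _ => by ring
    rw [this]
    ring

lemma sum_range_pos (hg : ∀ k, 0 < g k) (n : ℕ) : 0 < ∑ k ∈ Finset.range (n + 1), g k :=
  Finset.sum_pos (fun k _ => hg k) ⟨0, by simp⟩

lemma indexVar_eq (hg : ∀ k, 0 < g k) (n : ℕ) :
    indexVar g (n + 1) = (∑ j ∈ Finset.range (n + 1), ∑ i ∈ Finset.range j,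
      g i * g j * ((j : ℝ) - i) ^ 2) / (∑ k ∈ Finset.range (n + 1), g k) ^ 2 := by
  have hW := (sum_range_pos hg n).ne'
  rw [← sum_mul_sum_sub_sq, indexVar]
  field_simp

/-- The successive ratios `g (k + 1) / g k` shrink by a factor `r` at each step, so the ratio at `i
+ t` is at most `r ^ t` times the ratio at `i`. -/
lemma mul_add_le_of_logConcave {r : ℝ} (hr : 0 ≤ r) (hg : ∀ k, 0 < g k)
    (hlc : ∀ k, g k * g (k + 2) ≤ r * g (k + 1) ^ 2) (i t : ℕ) :
    g i * g (i + t + 1) ≤ r ^ t * (g (i + 1) * g (i + t)) := by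
  induction t with
  | zero => simp [mul_comm]
  | succ t ih =>
    have h1 := hlc (i + t)
    refine le_of_mul_le_mul_right ?_ (hg (i + t))
    calc g i * g (i + (t + 1) + 1) * g (i + t)
        = g i * (g (i + t) * g (i + t + 2)) := by ring_nf
      _ ≤ g i * (r * g (i + t + 1) ^ 2) := by gcongr; exact (hg i).le
      _ = r * g (i + t + 1) * (g i * g (i + t + 1)) := by ring
      _ ≤ r * g (i + t + 1) * (r ^ t * (g (i + 1) * g (i + t))) := by
          gcongr
          exact mul_nonneg hr (hg _).le
      _ = r ^ (t + 1) * (g (i + 1) * g (i + (t + 1))) * g (i + t) := by ring_nf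

/-- Multiplying the previous bound by `g i * g (i + t + 1)` regroups the right side as a product of
the first and the last adjacent pair, to which AM-GM applies. Distant pairs are thereby charged to
adjacent ones. -/
lemma mul_add_le_mean {r : ℝ} (hr : 0 ≤ r) (hg : ∀ k, 0 < g k)
    (hlc : ∀ k, g k * g (k + 2) ≤ r ^ 2 * g (k + 1) ^ 2) (i t : ℕ) :
    g i * g (i + t + 1) ≤ r ^ t * ((g i * g (i + 1) + g (i + t) * g (i + t + 1)) / 2) := by
  have h1 := mul_add_le_of_logConcave (sq_nonneg r) hg hlc i t
  have p := fun k => (hg k).le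
  have hb1 : 0 ≤ g i * g (i + 1) := mul_nonneg (p _) (p _)
  have hb2 : 0 ≤ g (i + t) * g (i + t + 1) := mul_nonneg (p _) (p _)
  have hx : 0 ≤ g i * g (i + t + 1) := mul_nonneg (p _) (p _)
  refine (pow_le_pow_iff_left₀ hx (mul_nonneg (pow_nonneg hr _) (by linarith)) two_ne_zero).1 ?_
  calc (g i * g (i + t + 1)) ^ 2 = (g i * g (i + t + 1)) * (g i * g (i + t + 1)) := sq _
    _ ≤ (g i * g (i + t + 1)) * ((r ^ 2) ^ t * (g (i + 1) * g (i + t))) := by gcongr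
    _ = (r ^ t) ^ 2 * ((g i * g (i + 1)) * (g (i + t) * g (i + t + 1))) := by ring
    _ ≤ (r ^ t) ^ 2 * (((g i * g (i + 1) + g (i + t) * g (i + t + 1)) / 2) ^ 2) := by
        gcongr
        nlinarith [sq_nonneg (g i * g (i + 1) - g (i + t) * g (i + t + 1))]
    _ = _ := by ring

/-- The coefficients `t² r ^ (t - 1)` for `r = 1 / 54`. -/
def gapCoeff (t : ℕ) : ℝ := (t : ℝ) ^ 2 * (1 / 54) ^ (t - 1)

@[simp] lemma gapCoeff_zero : gapCoeff 0 = 0 := by simp [gapCoeff]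

lemma sum_gapCoeff_le (K : ℕ) : ∑ t ∈ Finset.range K, gapCoeff t ≤ 27 / 25 := by
  -- The full series is `(1 + r) / (1 - r)³ = 1.0773…` at `r = 1/54`, just below `27/25`. The
  -- subtracted remainder makes the induction close.
  have key : ∀ K : ℕ, ∑ t ∈ Finset.range (K + 1), gapCoeff t ≤
      27 / 25 - 27 / 25 * ((K : ℝ) + 1) ^ 2 * (1 / 54) ^ K := by
    intro K
    induction K with
    | zero => simp
    | succ K ih =>
      rw [Finset.sum_range_succ]
      have h : gapCoeff (K + 1) = ((K : ℝ) + 1) ^ 2 * (1 / 54) ^ K := by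
        simp [gapCoeff]
      rw [h]
      have hp : (0 : ℝ) < (1 / 54) ^ K := by positivity
      have hK : (0 : ℝ) ≤ K := K.cast_nonneg
      have : ((K : ℝ) + 1) ^ 2 ≤ 27 / 25 * (K + 1) ^ 2 - 27 / 25 * (K + 1 + 1) ^ 2 * (1 / 54) := by
        nlinarith
      have := mul_le_mul_of_nonneg_right this hp.le
      push_cast
      rw [pow_succ (1 / 54 : ℝ) K]
      nlinarith
  rcases K with _ | K
  · norm_num
  · refine (key K).trans ?_
    have : 0 ≤ 27 / 25 * ((K : ℝ) + 1) ^ 2 * (1 / 54) ^ K := by positivity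
    linarith

lemma sum_gapCoeff_sub_le (N i : ℕ) : ∑ n ∈ Finset.range N, gapCoeff (n - i) ≤ 27 / 25 := by
  rcases le_total N i with h | h
  · rw [Finset.sum_eq_zero]
    · norm_num
    · intro n hn
      rw [Nat.sub_eq_zero_of_le (by grind), gapCoeff_zero]
  · obtain ⟨K, rfl⟩ := Nat.exists_eq_add_of_le h
    rw [Finset.sum_range_add, Finset.sum_eq_zero, zero_add]
    · simpa using sum_gapCoeff_le K
    · intro n hn
      rw [Nat.sub_eq_zero_of_le (by grind), gapCoeff_zero]

lemma sum_gapCoeff_sub_le' (n : ℕ) : ∑ i ∈ Finset.range n, gapCoeff (n - i) ≤ 27 / 25 := by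
  refine le_trans (le_of_eq ?_) (sum_gapCoeff_le (n + 1))
  rw [← Finset.sum_range_reflect, Finset.sum_range_succ', gapCoeff_zero, add_zero]
  refine Finset.sum_congr rfl fun i hi => ?_
  congr 1
  grind

/-- Each pair `i < j` is charged half to the adjacent pair starting at `i` and half to the one
ending at `j`. Either way an adjacent pair collects at most the series of `gapCoeff`. -/
lemma sum_pairs_le (hg : ∀ k, 0 < g k)
    (hlc : ∀ k, g k * g (k + 2) ≤ (1 / 54) ^ 2 * g (k + 1) ^ 2) (m : ℕ) :
    ∑ j ∈ Finset.range (m + 1), ∑ i ∈ Finset.range j, g i * g j * ((j : ℝ) - i) ^ 2 ≤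
      27 / 25 * ∑ k ∈ Finset.range m, g k * g (k + 1) := by
  set b : ℕ → ℝ := fun k => g k * g (k + 1) with hb
  have hb0 : ∀ k, 0 ≤ b k := fun k => mul_nonneg (hg _).le (hg _).le
  have step : ∀ j, ∀ i ∈ Finset.range j, g i * g j * ((j : ℝ) - i) ^ 2 ≤
      gapCoeff (j - i) * b i / 2 + gapCoeff (j - i) * b (j - 1) / 2 := by
    intro j i hi
    obtain ⟨t, rfl⟩ := Nat.exists_eq_add_of_lt (Finset.mem_range.1 hi)
    have h := mul_add_le_mean (by norm_num) hg hlc i t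
    have h2 : i + t + 1 - i = t + 1 := by omega
    have h3 : ((i + t + 1 : ℕ) : ℝ) - i = t + 1 := by push_cast; ring
    rw [h2, h3]
    simp only [gapCoeff, hb, Nat.add_sub_cancel]
    push_cast
    nlinarith [mul_le_mul_of_nonneg_right h (sq_nonneg ((t : ℝ) + 1))]
  have h1 : ∑ j ∈ Finset.range (m + 1), ∑ i ∈ Finset.range j, gapCoeff (j - i) * b i ≤
      27 / 25 * ∑ k ∈ Finset.range m, b k := by
    have : ∀ j ∈ Finset.range (m + 1), ∑ i ∈ Finset.range j, gapCoeff (j - i) * b i =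
        ∑ i ∈ Finset.range m, gapCoeff (j - i) * b i := by
      intro j hj
      refine Finset.sum_subset (fun i hi => by grind) (fun i _ hi => ?_)
      rw [Nat.sub_eq_zero_of_le (by grind), gapCoeff_zero, zero_mul]
    rw [Finset.sum_congr rfl this, Finset.sum_comm, Finset.mul_sum]
    refine Finset.sum_le_sum fun i _ => ?_
    rw [← Finset.sum_mul]
    exact mul_le_mul_of_nonneg_right (sum_gapCoeff_sub_le _ _) (hb0 i)
  have h2 : ∑ j ∈ Finset.range (m + 1), ∑ i ∈ Finset.range j, gapCoeff (j - i) * b (j - 1) ≤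
      27 / 25 * ∑ k ∈ Finset.range m, b k := by
    rw [Finset.sum_range_succ', Finset.range_zero, Finset.sum_empty, add_zero, Finset.mul_sum]
    refine Finset.sum_le_sum fun j _ => ?_
    rw [← Finset.sum_mul]
    exact mul_le_mul_of_nonneg_right (sum_gapCoeff_sub_le' _) (hb0 j)
  calc _ ≤ ∑ j ∈ Finset.range (m + 1), ∑ i ∈ Finset.range j,
        (gapCoeff (j - i) * b i / 2 + gapCoeff (j - i) * b (j - 1) / 2) :=
        Finset.sum_le_sum fun j _ => Finset.sum_le_sum (step j)
    _ = (∑ j ∈ Finset.range (m + 1), ∑ i ∈ Finset.range j, gapCoeff (j - i) * b i) / 2 +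
        (∑ j ∈ Finset.range (m + 1), ∑ i ∈ Finset.range j, gapCoeff (j - i) * b (j - 1)) / 2 := by
        simp only [Finset.sum_add_distrib, Finset.sum_div]
    _ ≤ _ := by linarith

lemma add_le_sum_range (hg : ∀ k, 0 < g k) {m k : ℕ} (hk : k < m) :
    g k + g (k + 1) ≤ ∑ j ∈ Finset.range (m + 1), g j := by
  have : ∑ j ∈ ({k, k + 1} : Finset ℕ), g j = g k + g (k + 1) :=
    Finset.sum_pair (by omega)
  rw [← this]
  exact Finset.sum_le_sum_of_subset_of_nonneg (fun i hi => by grind) fun i _ _ => (hg i).le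

theorem sum_mul_indexVar_le (hg : ∀ k, 0 < g k)
    (hlc : ∀ k, g k * g (k + 2) ≤ (1 / 54) ^ 2 * g (k + 1) ^ 2) (m : ℕ) :
    (∑ k ∈ Finset.range (m + 1), g k) * indexVar g (m + 1) ≤
      27 / 25 * ∑ k ∈ Finset.range m, pairWeight g k := by
  have hW := sum_range_pos hg m
  set W := ∑ k ∈ Finset.range (m + 1), g k with hWdef
  calc W * indexVar g (m + 1) = (∑ j ∈ Finset.range (m + 1), ∑ i ∈ Finset.range j,
      g i * g j * ((j : ℝ) - i) ^ 2) / W := by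
        rw [indexVar_eq hg, ← hWdef]; field_simp
    _ ≤ (27 / 25 * ∑ k ∈ Finset.range m, g k * g (k + 1)) / W := by
        gcongr; exact sum_pairs_le hg hlc m
    _ = 27 / 25 * ∑ k ∈ Finset.range m, g k * g (k + 1) / W := by
        rw [mul_div_assoc, Finset.sum_div]
    _ ≤ _ := by
        gcongr with k hk
        have := hg k
        have := hg (k + 1)
        rw [pairWeight]
        gcongr
        exact add_le_sum_range hg (Finset.mem_range.1 hk)

lemma sum_shift_le_of_decay {a : ℕ} (hg : ∀ k, 0 < g k) (h : ∀ k, a ≤ k → 54 * g (k + 1) ≤ g k)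
    (n : ℕ) : ∑ j ∈ Finset.range n, g (a + j) ≤ 54 / 53 * g a := by
  induction n generalizing a with
  | zero => simpa using (hg a).le
  | succ n ih =>
    rw [Finset.sum_range_succ']
    have := @ih (a + 1) (fun k hk => h k (by omega))
    have h2 := h a le_rfl
    have : ∑ j ∈ Finset.range n, g (a + (j + 1)) ≤ 54 / 53 * g (a + 1) := by
      refine le_trans (le_of_eq ?_) this
      exact Finset.sum_congr rfl fun j _ => by congr 1; ring
    simp only [add_zero]
    linarith

lemma sum_range_le_of_growth {k : ℕ} (hg : ∀ k, 0 < g k) (h : ∀ j, j < k → 54 * g j ≤ g (j + 1)) :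
    ∑ j ∈ Finset.range k, g j ≤ 1 / 53 * g k := by
  induction k with
  | zero => simpa using (hg 0).le
  | succ k ih =>
    rw [Finset.sum_range_succ]
    have := ih (fun j hj => h j (by omega))
    have := h k (by omega)
    linarith

lemma pairWeight_pos (hg : ∀ k, 0 < g k) (k : ℕ) : 0 < pairWeight g k :=
  div_pos (mul_pos (hg _) (hg _)) (add_pos (hg _) (hg _))

/-- The lower bound that a single dominating pair of weights gives. -/
lemma pair_bound {x y o : ℝ} (hx : 0 < x) (hy : 0 < y) (ho : 0 ≤ o)
    (h : x * y * o ≤ 54 / 53 * (1 / 54) ^ 2 * (x ^ 3 + y ^ 3)) :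
    x * y / (x + y) * ((54 * (x * y / (x + y) / (x + y)) - 53 / 50) / 50) ≤
      (x * y) ^ 2 / (x + y + o) ^ 3 := by
  set r := x + y with hr
  set b := x * y with hb
  have hr0 : 0 < r := add_pos hx hy
  have hb0 : 0 < b := mul_pos hx hy
  have hbr : b / r / r ≤ 1 / 4 := by
    rw [div_div, div_le_iff₀ (by positivity)]
    nlinarith [sq_nonneg (x - y)]
  have h3 : b * o ≤ 54 / 53 * (1 / 54) ^ 2 * r ^ 3 := by
    refine h.trans ?_
    gcongr
    have : 0 < x * y * (x + y) := by positivity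
    rw [hr]; nlinarith
  have hq : b / r / r * (3 * o / r) ≤ 162 / 53 * (1 / 54) ^ 2 := by
    have : b / r / r * (3 * o / r) = 3 * (b * o) / r ^ 3 := by field_simp
    rw [this, div_le_iff₀ (by positivity)]
    linarith
  have hcube : 1 - 3 * o / r ≤ r ^ 3 / (r + o) ^ 3 := by
    rw [le_div_iff₀ (by positivity)]
    have : (1 - 3 * o / r) * (r + o) ^ 3 = r ^ 3 - (6 * r * o ^ 2 + 8 * o ^ 3 + 3 * o ^ 4 / r) := by
      field_simp; ring
    rw [this]
    have : 0 ≤ 6 * r * o ^ 2 + 8 * o ^ 3 + 3 * o ^ 4 / r := by positivity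
    linarith
  have hfin : b ^ 2 / (r + o) ^ 3 = b / r * (b / r / r * (r ^ 3 / (r + o) ^ 3)) := by
    field_simp
  rw [hfin]
  have hq0 : 0 ≤ b / r / r := by positivity
  gcongr
  -- With `q = b / r / r`, what is needed is `(54 q - 53/50) / 50 ≤ q - (162/53) / 54²`. The left
  -- slope `54/50` exceeds 1, so the worst case is `q = 1/4`, where the inequality still holds with
  -- a small margin.
  nlinarith [mul_le_mul_of_nonneg_left hcube hq0]

/-- The affine function of `q` is negative for every pair with ratio at least 54, and log-concavity
allows at most one more balanced pair. That pair alone supplies the lower bound, yet the estimate is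
stated as a sum over all pairs, so that it can be integrated pair by pair. -/
theorem le_sum_mul_indexVar_sq (hg : ∀ k, 0 < g k)
    (hlc : ∀ k, g k * g (k + 2) ≤ (1 / 54) ^ 2 * g (k + 1) ^ 2) (m : ℕ) :
    ∑ k ∈ Finset.range m, pairWeight g k *
        ((54 * (pairWeight g k / (g k + g (k + 1))) - 53 / 50) / 50) ≤
      (∑ k ∈ Finset.range (m + 1), g k) * indexVar g (m + 1) ^ 2 := by
  have hW := sum_range_pos hg m
  -- A ratio of at least 54 forces `q ≤ 1/54`, hence `54 q - 53/50 < 0`.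
  have hsmall : ∀ k, (54 * g (k + 1) ≤ g k ∨ 54 * g k ≤ g (k + 1)) → pairWeight g k *
        ((54 * (pairWeight g k / (g k + g (k + 1))) - 53 / 50) / 50) ≤ 0 := by
    intro k hk
    refine mul_nonpos_of_nonneg_of_nonpos (pairWeight_pos hg k).le ?_
    have hx := hg k
    have hy := hg (k + 1)
    have : pairWeight g k / (g k + g (k + 1)) ≤ 1 / 54 := by
      rw [pairWeight, div_div, div_le_iff₀ (by positivity)]
      rcases hk with hk | hk <;> nlinarith
    linarith
  by_cases hex : ∃ k < m, g k < 54 * g (k + 1) ∧ g (k + 1) < 54 * g k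
  swap
  · push Not at hex
    refine le_trans (Finset.sum_nonpos fun k hk => hsmall k ?_) (by positivity)
    by_contra hcon
    push Not at hcon
    exact absurd (hex k (Finset.mem_range.1 hk) hcon.1) (not_le.2 hcon.2)
  obtain ⟨k₀, hk₀, h1, h2⟩ := hex
  -- The ratio at `k₀` is below 54 and drops by `54²` at each step, so from `k₀ + 1` on it is below
  -- `1/54`. The argument below `k₀` is symmetric.
  have hdec : ∀ k, k₀ + 1 ≤ k → 54 * g (k + 1) ≤ g k := by
    intro k hk
    obtain ⟨t, rfl⟩ := Nat.exists_eq_add_of_le hk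
    have := mul_add_le_of_logConcave (by positivity) hg hlc k₀ (t + 1)
    have hp : ((1 / 54 : ℝ) ^ 2) ^ (t + 1) ≤ (1 / 54) ^ 2 := by
      refine pow_le_of_le_one (by positivity) (by norm_num) (by omega)
    have h5 := hg k₀
    have h6 := hg (k₀ + (t + 1))
    have h7 := hg (k₀ + 1)
    have e1 : k₀ + (t + 1) + 1 = k₀ + 1 + t + 1 := by ring
    have e2 : k₀ + (t + 1) = k₀ + 1 + t := by ring
    rw [e1, e2] at this
    rw [e2] at h6
    have h8 : g k₀ * g (k₀ + 1 + t + 1) ≤ (1 / 54) ^ 2 * (g (k₀ + 1) * g (k₀ + 1 + t)) :=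
      this.trans (by gcongr)
    refine le_of_mul_le_mul_left (a := g k₀) ?_ h5
    nlinarith
  have hinc : ∀ k, k < k₀ → 54 * g k ≤ g (k + 1) := by
    intro k hk
    obtain ⟨t, rfl⟩ := Nat.exists_eq_add_of_lt hk
    have := mul_add_le_of_logConcave (by positivity) hg hlc k (t + 1)
    have hp : ((1 / 54 : ℝ) ^ 2) ^ (t + 1) ≤ (1 / 54) ^ 2 := by
      refine pow_le_of_le_one (by positivity) (by norm_num) (by omega)
    have h5 := hg k
    have h6 := hg (k + t + 1)
    have h7 := hg (k + 1)
    have h9 := hg (k + t + 1 + 1)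
    have h8 : g k * g (k + t + 1 + 1) ≤ (1 / 54) ^ 2 * (g (k + 1) * g (k + t + 1)) :=
      this.trans (by gcongr; exact le_rfl)
    refine le_of_mul_le_mul_right (a := g (k + t + 1 + 1)) ?_ h9
    nlinarith
  set o := ∑ j ∈ Finset.range k₀, g j + ∑ j ∈ Finset.range (m - k₀ - 1), g (k₀ + 2 + j) with ho
  have ho0 : 0 ≤ o := add_nonneg (Finset.sum_nonneg fun j _ => (hg _).le)
    (Finset.sum_nonneg fun j _ => (hg _).le)
  have hsum : ∑ k ∈ Finset.range (m + 1), g k = g k₀ + g (k₀ + 1) + o := by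
    have : m + 1 = k₀ + 1 + 1 + (m - k₀ - 1) := by omega
    rw [this, Finset.sum_range_add, Finset.sum_range_succ, Finset.sum_range_succ, ho]
    ring
  -- The geometric sum below `k₀` is at most `54/53` times its last term, and log-concavity at `k₀`
  -- bounds that term times `g (k₀ + 1)`.
  have hlow : g (k₀ + 1) * ∑ j ∈ Finset.range k₀, g j ≤ 54 / 53 * (1 / 54) ^ 2 * g k₀ ^ 2 := by
    rcases k₀ with _ | k
    · simp only [Finset.range_zero, Finset.sum_empty, mul_zero]; positivity
    · rw [Finset.sum_range_succ]
      have e := sum_range_le_of_growth hg (k := k) (fun j hj => hinc j (by omega))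
      have := hlc k
      nlinarith [mul_le_mul_of_nonneg_left e (hg (k + 2)).le]
  have hupp : g k₀ * ∑ j ∈ Finset.range (m - k₀ - 1), g (k₀ + 2 + j) ≤
      54 / 53 * (1 / 54) ^ 2 * g (k₀ + 1) ^ 2 := by
    have e := sum_shift_le_of_decay (a := k₀ + 2) hg (fun k hk => hdec k (by omega)) (m - k₀ - 1)
    have := hlc k₀
    nlinarith [mul_le_mul_of_nonneg_left e (hg k₀).le]
  have hpair := pair_bound (hg k₀) (hg (k₀ + 1)) ho0 (by
    have := mul_le_mul_of_nonneg_left hlow (hg k₀).le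
    have := mul_le_mul_of_nonneg_left hupp (hg (k₀ + 1)).le
    rw [ho]; nlinarith)
  have hvar : g k₀ * g (k₀ + 1) ≤ ∑ j ∈ Finset.range (m + 1), ∑ i ∈ Finset.range j,
      g i * g j * ((j : ℝ) - i) ^ 2 := by
    have hnn : ∀ i j, 0 ≤ g i * g j * ((j : ℝ) - i) ^ 2 := fun i j =>
      mul_nonneg (mul_nonneg (hg _).le (hg _).le) (sq_nonneg _)
    calc g k₀ * g (k₀ + 1) = g k₀ * g (k₀ + 1) * (((k₀ + 1 : ℕ) : ℝ) - k₀) ^ 2 := by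
          push_cast; ring
      _ ≤ ∑ i ∈ Finset.range (k₀ + 1), g i * g (k₀ + 1) * (((k₀ + 1 : ℕ) : ℝ) - i) ^ 2 :=
          Finset.single_le_sum (f := fun i => g i * g (k₀ + 1) * (((k₀ + 1 : ℕ) : ℝ) - i) ^ 2)
            (fun i _ => hnn i _) (by simp)
      _ ≤ _ := Finset.single_le_sum (f := fun j : ℕ => ∑ i ∈ Finset.range j,
            g i * g j * ((j : ℝ) - i) ^ 2)
            (fun j _ => Finset.sum_nonneg fun i _ => hnn i _) (by simpa using hk₀)
  calc _ ≤ pairWeight g k₀ *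
        ((54 * (pairWeight g k₀ / (g k₀ + g (k₀ + 1))) - 53 / 50) / 50) := by
        rw [← Finset.add_sum_erase _ _ (Finset.mem_range.2 hk₀)]
        refine add_le_of_nonpos_right (Finset.sum_nonpos fun k hk => hsmall k ?_)
        rcases lt_or_gt_of_ne (Finset.ne_of_mem_erase hk) with h | h
        · exact Or.inr (hinc k h)
        · exact Or.inl (hdec k h)
    _ ≤ (g k₀ * g (k₀ + 1)) ^ 2 / (g k₀ + g (k₀ + 1) + o) ^ 3 := hpair
    _ = (∑ k ∈ Finset.range (m + 1), g k) *
        (g k₀ * g (k₀ + 1) / (∑ k ∈ Finset.range (m + 1), g k) ^ 2) ^ 2 := by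
        rw [← hsum]; field_simp
    _ ≤ _ := by
        rw [indexVar_eq hg]
        have := mul_pos (hg k₀) (hg (k₀ + 1))
        gcongr

end LogConcave

/-! ### The one-dimensional integral inequality for a single pair. -/

section PairIntegral

lemma integrable_exp_neg_sq_half : Integrable fun v : ℝ => Real.exp (-v ^ 2 / 2) := by
  have := integrable_exp_neg_mul_sq (b := 1 / 2) (by norm_num)
  refine this.congr (Filter.Eventually.of_forall fun v => ?_)
  dsimp only
  congr 1
  ring

lemma integrable_abs_mul_exp_neg_sq_half :
    Integrable fun v : ℝ => |v| * Real.exp (-v ^ 2 / 2) := by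
  have := (integrable_mul_exp_neg_mul_sq (b := 1 / 2) (by norm_num)).norm
  refine this.congr (Filter.Eventually.of_forall fun v => ?_)
  simp only [norm_mul, Real.norm_eq_abs, Real.abs_exp]
  congr 2
  ring

lemma integrable_of_continuous_of_abs_le {f g : ℝ → ℝ} (hg : Integrable g) (hf : Continuous f)
    (h : ∀ v, |f v| ≤ g v) : Integrable f :=
  hg.mono' hf.aestronglyMeasurable (Filter.Eventually.of_forall fun v => by simpa using h v)

lemma continuous_exp_neg_sq_div_cosh_pow (h : ℝ) (n : ℕ) :
    Continuous fun v : ℝ => Real.exp (-v ^ 2 / 2) / Real.cosh (h * v) ^ n :=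
  Continuous.div (by fun_prop) (by fun_prop) fun v => pow_ne_zero _ (Real.cosh_pos _).ne'

lemma integrable_exp_neg_sq_div_cosh_pow (h : ℝ) (n : ℕ) :
    Integrable fun v : ℝ => Real.exp (-v ^ 2 / 2) / Real.cosh (h * v) ^ n := by
  refine integrable_of_continuous_of_abs_le integrable_exp_neg_sq_half
    (continuous_exp_neg_sq_div_cosh_pow h n) fun v => ?_
  have hc := Real.cosh_pos (h * v)
  rw [abs_of_nonneg (by positivity)]
  exact div_le_self (Real.exp_pos _).le (one_le_pow₀ (Real.one_le_cosh _))

lemma abs_sinh_le_cosh (x : ℝ) : |Real.sinh x| ≤ Real.cosh x := by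
  refine abs_le_of_sq_le_sq ?_ (Real.cosh_pos x).le
  nlinarith [Real.cosh_sq x]

/-- This is `tanh y ≤ y` for `y ≥ 0`, multiplied by `sinh y * cosh y`; both sides are even. -/
lemma sinh_sq_le_mul_sinh_mul_cosh (x : ℝ) : Real.sinh x ^ 2 ≤ x * Real.sinh x * Real.cosh x := by
  have key : ∀ y : ℝ, 0 ≤ y → Real.sinh y ≤ y * Real.cosh y := by
    intro y hy
    have hmono : MonotoneOn (fun y : ℝ => y * Real.cosh y - Real.sinh y) (Set.Ici 0) := by
      refine monotoneOn_of_deriv_nonneg (convex_Ici 0) (by fun_prop) (by fun_prop) ?_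
      intro z hz
      have hz' : 0 < z := by simpa using hz
      have hd : HasDerivAt (fun y : ℝ => y * Real.cosh y - Real.sinh y)
          (1 * Real.cosh z + z * Real.sinh z - Real.cosh z) z :=
        ((hasDerivAt_id z).mul (Real.hasDerivAt_cosh z)).sub (Real.hasDerivAt_sinh z)
      rw [hd.deriv]
      have := Real.sinh_pos_iff.2 hz'
      nlinarith
    have := hmono (Set.mem_Ici.2 le_rfl) (Set.mem_Ici.2 hy) hy
    simp at this
    linarith
  rcases le_total 0 x with hx | hx
  · have := Real.sinh_nonneg_iff.2 hx
    nlinarith [key x hx]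
  · have h1 := Real.sinh_nonpos_iff.2 hx
    have h2 := key (-x) (by linarith)
    rw [Real.sinh_neg, Real.cosh_neg] at h2
    nlinarith

/-- Integration by parts against `tanh (h v) exp (-v² / 2) / cosh (h v)`. -/
theorem integral_exp_neg_sq_div_cosh_le {h : ℝ} (hh : 0 < h) :
    (h ^ 2 + 1) * ∫ v : ℝ, Real.exp (-v ^ 2 / 2) / Real.cosh (h * v) ^ 1 ≤
      (2 * h ^ 2 + 1) * ∫ v : ℝ, Real.exp (-v ^ 2 / 2) / Real.cosh (h * v) ^ 3 := by
  set F : ℝ → ℝ := fun v => Real.sinh (h * v) * Real.exp (-v ^ 2 / 2) / Real.cosh (h * v) ^ 2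
  set T : ℝ → ℝ := fun v => v * Real.sinh (h * v) * Real.exp (-v ^ 2 / 2) / Real.cosh (h * v) ^ 2
  have hcp : ∀ v, 0 < Real.cosh (h * v) := fun v => Real.cosh_pos _
  have hcont : ∀ n : ℕ, ∀ v, Real.cosh (h * v) ^ n ≠ 0 := fun n v => pow_ne_zero _ (hcp v).ne'
  have i1 := integrable_exp_neg_sq_div_cosh_pow h 1
  have i3 := integrable_exp_neg_sq_div_cosh_pow h 3
  have hbound : ∀ v, |Real.sinh (h * v) * Real.exp (-v ^ 2 / 2) / Real.cosh (h * v) ^ 2| ≤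
      Real.exp (-v ^ 2 / 2) := by
    intro v
    have hc := hcp v
    rw [abs_div, abs_mul, Real.abs_exp, abs_of_pos (by positivity : 0 < Real.cosh (h * v) ^ 2),
      div_le_iff₀ (by positivity), mul_comm]
    gcongr
    refine (abs_sinh_le_cosh _).trans ?_
    nlinarith [Real.one_le_cosh (h * v)]
  have iF : Integrable F := by
    refine integrable_of_continuous_of_abs_le integrable_exp_neg_sq_half ?_ hbound
    exact Continuous.div (by fun_prop) (by fun_prop) (hcont 2)
  have iT : Integrable T := by
    refine integrable_of_continuous_of_abs_le integrable_abs_mul_exp_neg_sq_half ?_ fun v => ?_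
    · exact Continuous.div (by fun_prop) (by fun_prop) (hcont 2)
    · have : T v = v * (Real.sinh (h * v) * Real.exp (-v ^ 2 / 2) / Real.cosh (h * v) ^ 2) := by
        simp only [T]; ring
      rw [this, abs_mul]
      exact mul_le_mul_of_nonneg_left (hbound v) (abs_nonneg v)
  -- Replacing `sinh²` by `cosh² - 1` leaves only the powers 1 and 3 of `1 / cosh`. Integrating the
  -- derivative to zero gives `h (2 Q - Z) = ∫ T`, with `Z` and `Q` the integrals for the powers 1
  -- and 3.
  have hderiv : ∀ v, HasDerivAt F (h * (2 * (Real.exp (-v ^ 2 / 2) / Real.cosh (h * v) ^ 3) -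
      Real.exp (-v ^ 2 / 2) / Real.cosh (h * v) ^ 1) - T v) v := by
    intro v
    have hl : HasDerivAt (fun v : ℝ => h * v) h v := by simpa using (hasDerivAt_id v).const_mul h
    have hs := (Real.hasDerivAt_sinh (h * v)).comp v hl
    have hc := ((Real.hasDerivAt_cosh (h * v)).comp v hl).pow 2
    have he : HasDerivAt (fun v : ℝ => Real.exp (-v ^ 2 / 2)) (Real.exp (-v ^ 2 / 2) * (-v)) v := by
      have : HasDerivAt (fun v : ℝ => -v ^ 2 / 2) (-v) v :=
        (((hasDerivAt_pow 2 v).fun_neg).div_const 2).congr_deriv (by push_cast; ring)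
      exact this.exp
    refine ((hs.mul he).div hc (hcont 2 v)).congr_deriv ?_
    have hcv := (hcp v).ne'
    simp only [T, Function.comp, Pi.mul_apply, Pi.pow_apply]
    field_simp
    have e : Real.sinh (h * v) ^ 2 = Real.cosh (h * v) ^ 2 - 1 := by
      linarith [Real.cosh_sq (h * v)]
    norm_num
    linear_combination (-2 * h * Real.cosh (h * v)) * e
  have i31 : Integrable fun v : ℝ => 2 * (Real.exp (-v ^ 2 / 2) / Real.cosh (h * v) ^ 3) -
      Real.exp (-v ^ 2 / 2) / Real.cosh (h * v) ^ 1 := (i3.const_mul 2).sub i1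
  have hI := integral_eq_zero_of_hasDerivAt_of_integrable hderiv
    ((i31.const_mul h).sub iT) iF
  rw [integral_sub (i31.const_mul h) iT, integral_const_mul,
    integral_sub (i3.const_mul 2) i1, integral_const_mul] at hI
  -- Here `tanh` enters: `T` dominates `sinh² / (h cosh³)` times the Gaussian, which integrates to
  -- `(Z - Q) / h`.
  have hT : (1 / h) * (∫ v : ℝ, Real.exp (-v ^ 2 / 2) / Real.cosh (h * v) ^ 1) -
      (1 / h) * (∫ v : ℝ, Real.exp (-v ^ 2 / 2) / Real.cosh (h * v) ^ 3) ≤ ∫ v, T v := by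
    rw [← integral_const_mul, ← integral_const_mul, ← integral_sub (i1.const_mul _) (i3.const_mul _)]
    refine integral_mono ((i1.const_mul _).sub (i3.const_mul _)) iT fun v => ?_
    have hc := hcp v
    have e : Real.sinh (h * v) ^ 2 = Real.cosh (h * v) ^ 2 - 1 := by
      linarith [Real.cosh_sq (h * v)]
    have h1 := sinh_sq_le_mul_sinh_mul_cosh (h * v)
    have : 1 / h * (Real.exp (-v ^ 2 / 2) / Real.cosh (h * v) ^ 1) -
        1 / h * (Real.exp (-v ^ 2 / 2) / Real.cosh (h * v) ^ 3) =
        (1 / h * Real.sinh (h * v) ^ 2) * (Real.exp (-v ^ 2 / 2) / Real.cosh (h * v) ^ 3) := by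
      rw [e]; field_simp
    simp only [this]
    have h2 : T v = v * Real.sinh (h * v) * Real.cosh (h * v) *
        (Real.exp (-v ^ 2 / 2) / Real.cosh (h * v) ^ 3) := by
      simp only [T]; field_simp
    rw [h2]
    refine mul_le_mul_of_nonneg_right ?_ (by positivity)
    rw [one_div, inv_mul_le_iff₀ hh]
    linarith
  set Z := ∫ v : ℝ, Real.exp (-v ^ 2 / 2) / Real.cosh (h * v) ^ 1
  set Q := ∫ v : ℝ, Real.exp (-v ^ 2 / 2) / Real.cosh (h * v) ^ 3
  have h1 : h * ((1 / h) * Z - (1 / h) * Q) ≤ h * (h * (2 * Q - Z)) := by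
    gcongr; linarith
  have h2 : h * ((1 / h) * Z - (1 / h) * Q) = Z - Q := by field_simp
  nlinarith

end PairIntegral

/-! ### Gaussian weights on a lattice and the integrated variance inequality. -/

section LatticeGaussian

/-- Unnormalised unit variance Gaussian densities centred at `b (k - c) d`. -/
def latticeGaussian (b c d z : ℝ) (k : ℕ) : ℝ := Real.exp (-(z - b * ((k - c) * d)) ^ 2 / 2)

lemma latticeGaussian_pos (b c d z : ℝ) (k : ℕ) : 0 < latticeGaussian b c d z k := Real.exp_pos _

lemma exp_neg_eight_le : Real.exp (-8) ≤ (1 / 54) ^ 2 := by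
  have h1 : (54 : ℝ) ≤ Real.exp 4 := by
    have : Real.exp 4 = Real.exp 1 ^ 4 := by rw [← Real.exp_nat_mul]; norm_num
    rw [this]
    calc (54 : ℝ) ≤ 2.718 ^ 4 := by norm_num
      _ ≤ _ := by gcongr; linarith [Real.exp_one_gt_d9]
  have : Real.exp (-8) = (1 / Real.exp 4) ^ 2 := by
    rw [one_div, ← Real.exp_neg, ← Real.exp_nat_mul]; norm_num
  rw [this]
  gcongr

/-- The logarithm of the weights is quadratic in `k` with second difference exactly `-(b d)²`. -/
lemma latticeGaussian_logConcave {b d : ℝ} (hbd : 8 ≤ (b * d) ^ 2) (c z : ℝ) (k : ℕ) :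
    latticeGaussian b c d z k * latticeGaussian b c d z (k + 2) ≤
      (1 / 54) ^ 2 * latticeGaussian b c d z (k + 1) ^ 2 := by
  have : latticeGaussian b c d z k * latticeGaussian b c d z (k + 2) =
      Real.exp (-(b * d) ^ 2) * latticeGaussian b c d z (k + 1) ^ 2 := by
    simp only [latticeGaussian]
    rw [← Real.exp_nat_mul, ← Real.exp_add, ← Real.exp_add]
    congr 1
    push_cast
    ring
  rw [this]
  gcongr
  exact (Real.exp_le_exp.2 (by linarith)).trans exp_neg_eight_le

/-- Measured from the midpoint of the pair, the two weights are `E e^{-hv}` and `E e^{hv}` with a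
common factor `E`. Different `k` therefore give translates of the same function, with the same
integral. -/
lemma pairWeight_latticeGaussian (b c d z : ℝ) (k : ℕ) :
    pairWeight (latticeGaussian b c d z) k = Real.exp (-(b * d / 2) ^ 2 / 2) / 2 *
      (Real.exp (-(z - b * ((k + 1 / 2 - c) * d)) ^ 2 / 2) /
        Real.cosh (b * d / 2 * (z - b * ((k + 1 / 2 - c) * d))) ^ 1) ∧
    pairWeight (latticeGaussian b c d z) k /
        (latticeGaussian b c d z k + latticeGaussian b c d z (k + 1)) =
      1 / (4 * Real.cosh (b * d / 2 * (z - b * ((k + 1 / 2 - c) * d))) ^ 2) := by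
  set v := z - b * ((k + 1 / 2 - c) * d) with hv
  set h := b * d / 2 with hh
  set E := Real.exp (-h ^ 2 / 2) * Real.exp (-v ^ 2 / 2) with hE
  have e1 : latticeGaussian b c d z k = E * Real.exp (-(h * v)) := by
    rw [hE, latticeGaussian, ← Real.exp_add, ← Real.exp_add]
    congr 1
    rw [hv, hh]; ring
  have e2 : latticeGaussian b c d z (k + 1) = E * Real.exp (h * v) := by
    rw [hE, latticeGaussian, ← Real.exp_add, ← Real.exp_add]
    congr 1
    rw [hv, hh]; push_cast; ring
  have hE0 : 0 < E := by positivity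
  have hc := Real.cosh_pos (h * v)
  have e3 : latticeGaussian b c d z k + latticeGaussian b c d z (k + 1) =
      2 * E * Real.cosh (h * v) := by
    rw [e1, e2, Real.cosh_eq]; ring
  have e4 : latticeGaussian b c d z k * latticeGaussian b c d z (k + 1) = E ^ 2 := by
    rw [e1, e2]
    have : Real.exp (-(h * v)) * Real.exp (h * v) = 1 := by rw [← Real.exp_add]; simp
    linear_combination E ^ 2 * this
  have e5 : pairWeight (latticeGaussian b c d z) k = E / (2 * Real.cosh (h * v)) := by
    rw [pairWeight, e3, e4]; field_simp
  constructor
  · rw [e5, hE]; field_simp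
  · rw [e5, e3]; field_simp; norm_num

lemma continuous_latticeGaussian (b c d : ℝ) (k : ℕ) :
    Continuous fun z => latticeGaussian b c d z k := by
  unfold latticeGaussian; fun_prop

lemma integrable_latticeGaussian (b c d : ℝ) (k : ℕ) :
    Integrable fun z => latticeGaussian b c d z k :=
  integrable_exp_neg_sq_half.comp_sub_right (b * ((k - c) * d))

lemma continuous_indexVar_latticeGaussian (b c d : ℝ) (m : ℕ) :
    Continuous fun z => indexVar (latticeGaussian b c d z) (m + 1) := by
  have hne : ∀ z, ∑ k ∈ Finset.range (m + 1), latticeGaussian b c d z k ≠ 0 := fun z =>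
    (sum_range_pos (latticeGaussian_pos b c d z) m).ne'
  have h0 := continuous_latticeGaussian b c d
  unfold indexVar
  refine Continuous.sub (Continuous.div ?_ ?_ hne) ((Continuous.div ?_ ?_ hne).pow 2) <;>
  · refine continuous_finsetSum _ fun k _ => ?_
    fun_prop

lemma indexVar_nonneg {g : ℕ → ℝ} (hg : ∀ k, 0 < g k) (n : ℕ) : 0 ≤ indexVar g (n + 1) := by
  rw [indexVar_eq hg]
  refine div_nonneg (Finset.sum_nonneg fun j _ => Finset.sum_nonneg fun i _ => ?_) (sq_nonneg _)
  exact mul_nonneg (mul_nonneg (hg _).le (hg _).le) (sq_nonneg _)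

lemma indexVar_le {g : ℕ → ℝ} (hg : ∀ k, 0 < g k) (n : ℕ) :
    indexVar g (n + 1) ≤ (n : ℝ) ^ 2 := by
  have hW := sum_range_pos hg n
  have : (∑ k ∈ Finset.range (n + 1), (k : ℝ) ^ 2 * g k) / (∑ k ∈ Finset.range (n + 1), g k) ≤
      (n : ℝ) ^ 2 := by
    rw [div_le_iff₀ hW, Finset.mul_sum]
    refine Finset.sum_le_sum fun k hk => ?_
    have : (k : ℝ) ≤ n := by exact_mod_cast Finset.mem_range_succ_iff.1 hk
    have := hg k
    gcongr
  unfold indexVar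
  linarith [sq_nonneg ((∑ k ∈ Finset.range (n + 1), (k : ℝ) * g k) /
    (∑ k ∈ Finset.range (n + 1), g k))]

lemma integrable_latticeGaussian_mul_indexVar_pow (b c d : ℝ) (m p : ℕ) :
    Integrable fun z => (∑ k ∈ Finset.range (m + 1), latticeGaussian b c d z k) *
      indexVar (latticeGaussian b c d z) (m + 1) ^ p := by
  have h0 := continuous_latticeGaussian b c d
  have h1 := continuous_indexVar_latticeGaussian b c d m
  have hi : Integrable fun z => (∑ k ∈ Finset.range (m + 1), latticeGaussian b c d z k) *
      ((m : ℝ) ^ 2) ^ p :=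
    (integrable_finsetSum _ fun k _ => integrable_latticeGaussian b c d k).mul_const _
  refine integrable_of_continuous_of_abs_le hi ?_ fun z => ?_
  · exact (continuous_finsetSum _ fun k _ => h0 k).mul (h1.pow p)
  · have hg := latticeGaussian_pos b c d z
    have := sum_range_pos hg m
    have hv := indexVar_nonneg hg m
    rw [abs_of_nonneg (by positivity)]
    gcongr
    exact indexVar_le hg m

theorem integral_indexVar_le {b d : ℝ} (hb : 0 < b) (hd : 0 < d) (hbd : 8 ≤ (b * d) ^ 2) (c : ℝ)
    (m : ℕ) :
    ∫ z, (∑ k ∈ Finset.range (m + 1), latticeGaussian b c d z k) *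
      indexVar (latticeGaussian b c d z) (m + 1) ≤
    (b * d) ^ 2 * ∫ z, (∑ k ∈ Finset.range (m + 1), latticeGaussian b c d z k) *
      indexVar (latticeGaussian b c d z) (m + 1) ^ 2 := by
  set h := b * d / 2 with hh
  have hh0 : 0 < h := by positivity
  have hS : (b * d) ^ 2 = 4 * h ^ 2 := by rw [hh]; ring
  have hA : 2 ≤ h ^ 2 := by linarith
  -- The contribution of one pair to `(b d)²` times the lower bound minus the upper bound, with `q =
  -- 1 / (4 cosh²)`, `(b d)² = 4 h²` and the factor `e^{-h²/2} / 2` removed.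
  set φ : ℝ → ℝ := fun v => 27 / 25 * h ^ 2 * (Real.exp (-v ^ 2 / 2) / Real.cosh (h * v) ^ 3) -
    (4 * h ^ 2 * (53 / 2500) + 27 / 25) * (Real.exp (-v ^ 2 / 2) / Real.cosh (h * v) ^ 1) with hφ
  have i1 := integrable_exp_neg_sq_div_cosh_pow h 1
  have i3 := integrable_exp_neg_sq_div_cosh_pow h 3
  have iφ : Integrable φ := (i3.const_mul _).sub (i1.const_mul _)
  have hφ0 : 0 ≤ ∫ v, φ v := by
    rw [hφ, integral_sub (i3.const_mul _) (i1.const_mul _), integral_const_mul, integral_const_mul]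
    have key := integral_exp_neg_sq_div_cosh_le hh0
    have hZ : 0 ≤ ∫ v : ℝ, Real.exp (-v ^ 2 / 2) / Real.cosh (h * v) ^ 1 :=
      integral_nonneg fun v => by have := Real.cosh_pos (h * v); positivity
    set Z := ∫ v : ℝ, Real.exp (-v ^ 2 / 2) / Real.cosh (h * v) ^ 1
    set Q := ∫ v : ℝ, Real.exp (-v ^ 2 / 2) / Real.cosh (h * v) ^ 3
    set A := h ^ 2
    have hA1 : 0 < 2 * A + 1 := by linarith
    -- The bracket is a quadratic in `A = h²` whose larger root lies slightly below 2; this is where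
    -- `(b d)² ≥ 8` is spent a second time.
    have h1 : 0 ≤ (27 / 25 * A * (A + 1) - (4 * A * (53 / 2500) + 27 / 25) * (2 * A + 1)) * Z :=
      mul_nonneg (by nlinarith) hZ
    have h2 : 27 / 25 * A * ((A + 1) * Z) ≤ 27 / 25 * A * ((2 * A + 1) * Q) := by gcongr
    have h3 : 0 ≤ (2 * A + 1) * (27 / 25 * A * Q - (4 * A * (53 / 2500) + 27 / 25) * Z) := by
      nlinarith
    exact nonneg_of_mul_nonneg_right h3 hA1
  have j1 := integrable_latticeGaussian_mul_indexVar_pow b c d m 1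
  have j2 := integrable_latticeGaussian_mul_indexVar_pow b c d m 2
  simp only [pow_one] at j1
  set a : ℕ → ℝ := fun k => b * ((k + 1 / 2 - c) * d) with ha
  have hpt : ∀ z, Real.exp (-h ^ 2 / 2) / 2 * ∑ k ∈ Finset.range m, φ (z - a k) ≤
      (b * d) ^ 2 * ((∑ k ∈ Finset.range (m + 1), latticeGaussian b c d z k) *
        indexVar (latticeGaussian b c d z) (m + 1) ^ 2) -
      (∑ k ∈ Finset.range (m + 1), latticeGaussian b c d z k) *
        indexVar (latticeGaussian b c d z) (m + 1) := by
    intro z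
    have hg := latticeGaussian_pos b c d z
    have hlc := latticeGaussian_logConcave hbd c z
    have u1 := sum_mul_indexVar_le hg hlc m
    have u2 := mul_le_mul_of_nonneg_left (le_sum_mul_indexVar_sq hg hlc m) (sq_nonneg (b * d))
    refine le_trans (le_of_eq ?_) (sub_le_sub u2 u1)
    rw [Finset.mul_sum, Finset.mul_sum, Finset.mul_sum, ← Finset.sum_sub_distrib]
    refine Finset.sum_congr rfl fun k _ => ?_
    obtain ⟨p1, p2⟩ := pairWeight_latticeGaussian b c d z k
    rw [p2, p1, hS, ← hh]
    simp only [hφ, ha]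
    have := (Real.cosh_pos (h * (z - b * ((k + 1 / 2 - c) * d)))).ne'
    field_simp
    ring
  have hint : Integrable fun z => Real.exp (-h ^ 2 / 2) / 2 * ∑ k ∈ Finset.range m, φ (z - a k) :=
    (integrable_finsetSum _ fun k _ => iφ.comp_sub_right (a k)).const_mul _
  have hmono := integral_mono hint ((j2.const_mul ((b * d) ^ 2)).sub j1) hpt
  simp only [Pi.sub_apply] at hmono
  rw [integral_sub (j2.const_mul _) j1, integral_const_mul, integral_const_mul,
    integral_finsetSum _ fun k _ => iφ.comp_sub_right (a k)] at hmono
  have : 0 ≤ Real.exp (-h ^ 2 / 2) / 2 * ∑ k ∈ Finset.range m, ∫ z, φ (z - a k) := by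
    refine mul_nonneg (by positivity) (Finset.sum_nonneg fun k _ => ?_)
    rw [integral_sub_right_eq_self]
    exact hφ0
  linarith

end LatticeGaussian

/-! ### Stein's identity and differentiation along the heat flow. -/

section HeatFlow

lemma integrable_exp_mul_abs_gaussianReal (m : ℝ) (v : NNReal) (D : ℝ) :
    Integrable (fun z => Real.exp (D * |z|)) (gaussianReal m v) := by
  refine ((integrable_exp_mul_gaussianReal (μ := m) (v := v) D).add
    (integrable_exp_mul_gaussianReal (μ := m) (v := v) (-D))).mono'
    (by fun_prop) (Filter.Eventually.of_forall fun z => ?_)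
  simp only [Real.norm_eq_abs, Real.abs_exp, Pi.add_apply]
  rcases abs_cases z with ⟨h, _⟩ | ⟨h, _⟩ <;> rw [h]
  · exact le_add_of_nonneg_right (Real.exp_pos _).le
  · rw [mul_neg, ← neg_mul]
    exact le_add_of_nonneg_left (Real.exp_pos _).le

lemma integrable_gaussianReal_of_abs_le {m : ℝ} {v : NNReal} {f : ℝ → ℝ} (hf : Continuous f)
    {C D : ℝ} (h : ∀ z, |f z| ≤ C * Real.exp (D * |z|)) : Integrable f (gaussianReal m v) :=
  ((integrable_exp_mul_abs_gaussianReal m v D).const_mul C).mono' hf.aestronglyMeasurable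
    (Filter.Eventually.of_forall fun z => by simpa using h z)

lemma integrable_gaussianReal_iff {f : ℝ → ℝ} :
    Integrable f (gaussianReal 0 1) ↔ Integrable fun z => gaussianPDFReal 0 1 z * f z := by
  rw [gaussianReal_of_var_ne_zero 0 one_ne_zero,
    integrable_withDensity_iff_integrable_smul' (measurable_gaussianPDF 0 1)
      (Filter.Eventually.of_forall fun z => gaussianPDF_lt_top)]
  simp [toReal_gaussianPDF]

lemma gaussianPDFReal_zero_one (z : ℝ) :
    gaussianPDFReal 0 1 z = (√(2 * Real.pi))⁻¹ * Real.exp (-z ^ 2 / 2) := by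
  simp [gaussianPDFReal]

lemma abs_le_exp_abs (z : ℝ) : |z| ≤ Real.exp |z| := by
  linarith [Real.add_one_le_exp |z|]

/-- Stein's identity for the standard Gaussian. -/
theorem integral_mul_gaussianReal_eq_integral_deriv {f f' : ℝ → ℝ} (hf : ∀ z, HasDerivAt f (f' z) z)
    (hf' : Continuous f') {C D : ℝ} (hC : ∀ z, |f z| ≤ C * Real.exp (D * |z|))
    (hC' : ∀ z, |f' z| ≤ C * Real.exp (D * |z|)) :
    ∫ z, z * f z ∂(gaussianReal 0 1) = ∫ z, f' z ∂(gaussianReal 0 1) := by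
  have hfc : Continuous f := continuous_iff_continuousAt.2 fun z => (hf z).continuousAt
  have i1 : Integrable f (gaussianReal 0 1) := integrable_gaussianReal_of_abs_le hfc hC
  have i2 : Integrable f' (gaussianReal 0 1) := integrable_gaussianReal_of_abs_le hf' hC'
  have i3 : Integrable (fun z => z * f z) (gaussianReal 0 1) := by
    refine integrable_gaussianReal_of_abs_le (C := C) (D := D + 1) (by fun_prop) fun z => ?_
    rw [abs_mul, add_mul, one_mul, Real.exp_add, mul_comm |z|, ← mul_assoc]
    exact mul_le_mul (hC z) (abs_le_exp_abs z) (abs_nonneg z) ((abs_nonneg _).trans (hC z))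
  have hd : ∀ z, HasDerivAt (fun z => gaussianPDFReal 0 1 z * f z)
      (gaussianPDFReal 0 1 z * f' z - gaussianPDFReal 0 1 z * (z * f z)) z := by
    intro z
    have h1 : HasDerivAt (fun v : ℝ => -v ^ 2 / 2) (-z) z :=
      (((hasDerivAt_pow 2 z).fun_neg).div_const 2).congr_deriv (by push_cast; ring)
    have h2 : HasDerivAt (gaussianPDFReal 0 1) (gaussianPDFReal 0 1 z * (-z)) z := by
      have := h1.exp.const_mul (√(2 * Real.pi))⁻¹
      rw [gaussianPDFReal_zero_one, mul_assoc]
      exact this.congr_of_eventuallyEq (Filter.Eventually.of_forall gaussianPDFReal_zero_one)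
    exact (h2.mul (hf z)).congr_deriv (by ring)
  have := integral_eq_zero_of_hasDerivAt_of_integrable hd
    ((integrable_gaussianReal_iff.1 i2).sub (integrable_gaussianReal_iff.1 i3))
    (integrable_gaussianReal_iff.1 i1)
  rw [integral_sub (integrable_gaussianReal_iff.1 i2) (integrable_gaussianReal_iff.1 i3)] at this
  rw [integral_gaussianReal_eq_integral_smul one_ne_zero,
    integral_gaussianReal_eq_integral_smul one_ne_zero]
  simp only [smul_eq_mul]
  linarith

/-- The generator of Brownian motion: differentiating `E F(s, √s Z)` in `s`. -/
theorem hasDerivAt_integral_gaussian_sqrt {F Fs Fw Fww : ℝ → ℝ → ℝ}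
    (hcurve : ∀ s, 0 < s → ∀ z, HasDerivAt (fun s => F s (√s * z))
      (Fs s (√s * z) + z / (2 * √s) * Fw s (√s * z)) s)
    (hw : ∀ s, 0 < s → ∀ w, HasDerivAt (Fw s) (Fww s w) w)
    (cF : ∀ s, 0 < s → Continuous (F s)) (cFs : ∀ s, 0 < s → Continuous (Fs s))
    (cFww : ∀ s, 0 < s → Continuous (Fww s))
    (hbd : ∀ B, ∃ C D, 0 ≤ D ∧ ∀ s, 0 < s → s ≤ B → ∀ w, |F s w| ≤ C * Real.exp (D * |w|) ∧
      |Fs s w| ≤ C * Real.exp (D * |w|) ∧ |Fw s w| ≤ C * Real.exp (D * |w|) ∧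
      |Fww s w| ≤ C * Real.exp (D * |w|)) {s : ℝ} (hs : 0 < s) :
    HasDerivAt (fun s => ∫ z, F s (√s * z) ∂(gaussianReal 0 1))
      (∫ z, (Fs s (√s * z) + 1 / 2 * Fww s (√s * z)) ∂(gaussianReal 0 1)) s := by
  have cFw : ∀ s, 0 < s → Continuous (Fw s) := fun s hs =>
    continuous_iff_continuousAt.2 fun w => (hw s hs w).continuousAt
  obtain ⟨C, D, hD, hb⟩ := hbd (2 * s)
  have hC : 0 ≤ C := by
    have := (abs_nonneg _).trans (hb s hs (by linarith) 0).1
    simpa using this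
  have hexp : ∀ t, 0 < t → t ≤ 2 * s → ∀ z, Real.exp (D * |√t * z|) ≤
      Real.exp (D * √(2 * s) * |z|) := by
    intro t ht hts z
    rw [abs_mul, abs_of_nonneg (Real.sqrt_nonneg t), mul_assoc]
    gcongr
  have hsq : 0 < √s := Real.sqrt_pos.2 hs
  set E := D * √(2 * s) with hE
  have hE0 : 0 ≤ E := by positivity
  have hs2 : 0 < √(s / 2) := Real.sqrt_pos.2 (by linarith)
  have hmeas : ∀ t, 0 < t → Continuous fun z => F t (√t * z) := fun t ht =>
    (cF t ht).comp (by fun_prop)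
  have hmain := hasDerivAt_integral_of_dominated_loc_of_deriv_le (μ := gaussianReal 0 1)
    (F := fun s z => F s (√s * z)) (F' := fun s z => Fs s (√s * z) + z / (2 * √s) * Fw s (√s * z))
    -- Staying above `s / 2` bounds `1 / √t`, and staying below `2 s` gives one exponential growth
    -- rate for the whole window.
    (x₀ := s) (s := Set.Ioo (s / 2) (2 * s))
    (bound := fun z => (C + 1 / (2 * √(s / 2)) * C) * Real.exp ((E + 1) * |z|))
    (Ioo_mem_nhds (by linarith) (by linarith))
    (by
      filter_upwards [Ioi_mem_nhds hs] with t ht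
      exact (hmeas t ht).aestronglyMeasurable)
    (integrable_gaussianReal_of_abs_le (C := C) (D := E) (hmeas s hs) fun z =>
      (hb s hs (by linarith) _).1.trans
        (mul_le_mul_of_nonneg_left (hexp s hs (by linarith) z) hC))
    (by
      refine Continuous.aestronglyMeasurable ?_
      have h1 := cFs s hs
      have h2 := cFw s hs
      fun_prop)
    (by
      refine Filter.Eventually.of_forall fun z t ht => ?_
      have ht0 : 0 < t := by linarith [ht.1]
      have htq : √(s / 2) ≤ √t := Real.sqrt_le_sqrt ht.1.le
      obtain ⟨-, b1, b2, -⟩ := hb t ht0 ht.2.le (√t * z)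
      have he := hexp t ht0 ht.2.le z
      have he1 : Real.exp ((E + 1) * |z|) = Real.exp (E * |z|) * Real.exp |z| := by
        rw [← Real.exp_add]; ring_nf
      have hz1 : 1 ≤ Real.exp |z| := Real.one_le_exp (abs_nonneg z)
      rw [Real.norm_eq_abs]
      calc |Fs t (√t * z) + z / (2 * √t) * Fw t (√t * z)|
          ≤ |Fs t (√t * z)| + |z / (2 * √t)| * |Fw t (√t * z)| := by
            rw [← abs_mul]; exact abs_add_le _ _
        _ ≤ C * Real.exp (E * |z|) + (1 / (2 * √(s / 2)) * Real.exp |z|) *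
            (C * Real.exp (E * |z|)) := by
            have hq : |z / (2 * √t)| ≤ 1 / (2 * √(s / 2)) * Real.exp |z| := by
              rw [abs_div, abs_of_nonneg (by positivity : 0 ≤ 2 * √t), div_eq_mul_one_div, mul_comm]
              gcongr
              exact abs_le_exp_abs z
            have hq1 := b1.trans (mul_le_mul_of_nonneg_left he hC)
            have hq2 := b2.trans (mul_le_mul_of_nonneg_left he hC)
            gcongr
        _ ≤ C * Real.exp (E * |z|) * Real.exp |z| + (1 / (2 * √(s / 2)) * Real.exp |z|) *
            (C * Real.exp (E * |z|)) := by
            refine add_le_add_left ?_ _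
            exact le_mul_of_one_le_right (by positivity) hz1
        _ = _ := by rw [he1]; ring)
    ((integrable_exp_mul_abs_gaussianReal 0 1 (E + 1)).const_mul _)
    (Filter.Eventually.of_forall fun z t ht => hcurve t (by linarith [ht.1]) z)
  refine hmain.2.congr_deriv ?_
  have c1 : Continuous fun z => Fs s (√s * z) := (cFs s hs).comp (by fun_prop)
  have c2 : Continuous fun z => Fw s (√s * z) := (cFw s hs).comp (by fun_prop)
  have c3 : Continuous fun z => Fww s (√s * z) := (cFww s hs).comp (by fun_prop)
  have bd : ∀ {g : ℝ → ℝ}, (∀ w, |g w| ≤ C * Real.exp (D * |w|)) →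
      ∀ z, |g (√s * z)| ≤ C * Real.exp (E * |z|) := fun h z =>
    (h _).trans (mul_le_mul_of_nonneg_left (hexp s hs (by linarith) z) hC)
  have b1 := bd fun w => (hb s hs (by linarith) w).2.1
  have b2 := bd fun w => (hb s hs (by linarith) w).2.2.1
  have b3 := bd fun w => (hb s hs (by linarith) w).2.2.2
  have i1 := integrable_gaussianReal_of_abs_le (m := 0) (v := 1) c1 b1
  have i3 := integrable_gaussianReal_of_abs_le (m := 0) (v := 1) c3 b3
  have i2 : Integrable (fun z => z / (2 * √s) * Fw s (√s * z)) (gaussianReal 0 1) := by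
    refine (hmain.1.sub i1).congr (Filter.Eventually.of_forall fun z => ?_)
    simp
  -- The factor `z` from differentiating `√s z` becomes a second space derivative; the chain-rule
  -- factor `√s` cancels the `√s` in `z / (2 √s)`.
  have stein := integral_mul_gaussianReal_eq_integral_deriv (f := fun z => Fw s (√s * z))
    (f' := fun z => √s * Fww s (√s * z)) (C := (1 + √s) * C) (D := E)
    (fun z => by
      have h1 : HasDerivAt (fun z : ℝ => √s * z) √s z := by
        simpa using (hasDerivAt_id z).const_mul √s
      exact ((hw s hs (√s * z)).comp z h1).congr_deriv (mul_comm _ _))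
    (by fun_prop)
    (fun z => (b2 z).trans (by
      gcongr
      exact le_mul_of_one_le_left hC (by linarith)))
    (fun z => by
      rw [abs_mul, abs_of_pos hsq]
      calc √s * |Fww s (√s * z)| ≤ √s * (C * Real.exp (E * |z|)) := by gcongr; exact b3 z
        _ ≤ _ := by
          rw [← mul_assoc]
          gcongr
          linarith)
  rw [integral_add i1 i2, integral_add i1 (i3.const_mul _)]
  congr 1
  have : ∀ z, z / (2 * √s) * Fw s (√s * z) = 1 / (2 * √s) * (z * Fw s (√s * z)) := fun z => by ring
  simp only [this]
  rw [integral_const_mul, stein, integral_const_mul, integral_const_mul]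
  field_simp

end HeatFlow

/-! ### Exponentially weighted moments and the two derivatives of the entropy. -/

section ExpMoment

variable {ι : Type*} (t : Finset ι) (x : ι → ℝ)

/-- The `p`-th moment of the points `x i` under the weights `exp (x i w - s (x i)² / 2)`. -/
def expMoment (p : ℕ) (s w : ℝ) : ℝ :=
  ∑ i ∈ t, x i ^ p * Real.exp (x i * w - s * x i ^ 2 / 2)

/-- The variance of the points `x i` under the weights `exp (x i w - s (x i)² / 2)`. -/
def expVar (s w : ℝ) : ℝ :=
  expMoment t x 2 s w / expMoment t x 0 s w - (expMoment t x 1 s w / expMoment t x 0 s w) ^ 2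

variable {t x}

lemma expMoment_zero_pos (ht : t.Nonempty) (s w : ℝ) : 0 < expMoment t x 0 s w :=
  Finset.sum_pos (fun i _ => by simpa using Real.exp_pos _) ht

variable (t x) in
@[fun_prop]
lemma continuous_expMoment (p : ℕ) : Continuous fun q : ℝ × ℝ => expMoment t x p q.1 q.2 := by
  unfold expMoment; fun_prop

variable (t x) in
lemma hasDerivAt_expMoment (p : ℕ) (s w : ℝ) :
    HasDerivAt (expMoment t x p s) (expMoment t x (p + 1) s w) w := by
  unfold expMoment
  refine HasDerivAt.fun_sum fun i _ => ?_
  have h1 : HasDerivAt (fun w => x i * w - s * x i ^ 2 / 2) (x i) w := by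
    simpa using ((hasDerivAt_id w).const_mul (x i)).sub_const (s * x i ^ 2 / 2)
  exact (h1.exp.const_mul (x i ^ p)).congr_deriv (by ring)

variable (t x) in
-- The function `expMoment t x p` solves the backward heat equation: its `s`-derivative is `-1/2`
-- times its second `w`-derivative.
lemma hasDerivAt_expMoment_sqrt (p : ℕ) {s : ℝ} (hs : 0 < s) (z : ℝ) :
    HasDerivAt (fun s => expMoment t x p s (√s * z))
      (z / (2 * √s) * expMoment t x (p + 1) s (√s * z) -
        1 / 2 * expMoment t x (p + 2) s (√s * z)) s := by
  unfold expMoment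
  rw [Finset.mul_sum, Finset.mul_sum, ← Finset.sum_sub_distrib]
  refine HasDerivAt.fun_sum fun i _ => ?_
  have h0 := ((Real.hasDerivAt_sqrt hs.ne').mul_const z).const_mul (x i)
  have h1 := h0.sub (((hasDerivAt_id s).mul_const (x i ^ 2)).div_const 2)
  refine (h1.exp.const_mul (x i ^ p)).congr_deriv ?_
  simp only [id, Pi.sub_apply]
  ring

lemma abs_expMoment_le {A : ℝ} (hA : ∀ i ∈ t, |x i| ≤ A) (p : ℕ) (s w : ℝ) :
    |expMoment t x p s w| ≤ A ^ p * expMoment t x 0 s w := by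
  unfold expMoment
  rw [Finset.mul_sum]
  refine (Finset.abs_sum_le_sum_abs _ _).trans (Finset.sum_le_sum fun i hi => ?_)
  rw [abs_mul, abs_pow, Real.abs_exp, pow_zero, one_mul]
  gcongr
  exact hA i hi

lemma expMoment_zero_le {A : ℝ} (hA : ∀ i ∈ t, |x i| ≤ A) {s : ℝ} (hs : 0 ≤ s) (w : ℝ) :
    expMoment t x 0 s w ≤ t.card * Real.exp (A * |w|) := by
  unfold expMoment
  rw [← nsmul_eq_mul]
  refine Finset.sum_le_card_nsmul _ _ _ fun i hi => ?_
  rw [pow_zero, one_mul]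
  gcongr
  have h1 : x i * w ≤ A * |w| := by
    refine (le_abs_self _).trans ?_
    rw [abs_mul]
    gcongr
    exact hA i hi
  have : 0 ≤ s * x i ^ 2 / 2 := by positivity
  linarith

lemma abs_log_expMoment_zero_le (ht : t.Nonempty) {A : ℝ} (hA : ∀ i ∈ t, |x i| ≤ A) {s : ℝ}
    (hs : 0 ≤ s) (w : ℝ) :
    |Real.log (expMoment t x 0 s w)| ≤ Real.log t.card + A * |w| + s * A ^ 2 / 2 := by
  have hc : (1 : ℝ) ≤ t.card := by exact_mod_cast ht.card_pos
  have hA0 : 0 ≤ A := by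
    obtain ⟨i, hi⟩ := ht
    exact (abs_nonneg _).trans (hA i hi)
  have hlog : 0 ≤ Real.log t.card := Real.log_nonneg hc
  rw [abs_le]
  constructor
  · obtain ⟨i, hi⟩ := ht
    rw [Real.le_log_iff_exp_le (expMoment_zero_pos ⟨i, hi⟩ _ _)]
    refine le_trans ?_ (Finset.single_le_sum (f := fun i => x i ^ 0 *
      Real.exp (x i * w - s * x i ^ 2 / 2)) (fun j _ => by positivity) hi)
    rw [pow_zero, one_mul]
    gcongr
    have h1 : -(A * |w|) ≤ x i * w := by
      refine le_trans (neg_le_neg ?_) (neg_abs_le _)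
      rw [abs_mul]
      gcongr
      exact hA i hi
    have h2 : x i ^ 2 ≤ A ^ 2 := sq_le_sq' (by linarith [neg_abs_le (x i), hA i hi])
      ((le_abs_self _).trans (hA i hi))
    nlinarith
  · rw [Real.log_le_iff_le_exp (expMoment_zero_pos ht _ _)]
    refine (expMoment_zero_le hA hs w).trans ?_
    have hexp : (t.card : ℝ) * Real.exp (A * |w|) = Real.exp (Real.log t.card + A * |w|) := by
      rw [Real.exp_add, Real.exp_log (by linarith)]
    have : 0 ≤ s * A ^ 2 / 2 := by positivity
    exact hexp.le.trans (Real.exp_le_exp.2 (by linarith))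

lemma exists_abs_le_of_finset (t : Finset ι) (x : ι → ℝ) : ∃ A, 1 ≤ A ∧ ∀ i ∈ t, |x i| ≤ A := by
  refine ⟨1 + ∑ i ∈ t, |x i|, ?_, fun i hi => ?_⟩
  · exact le_add_of_nonneg_right (Finset.sum_nonneg fun i _ => abs_nonneg _)
  · have := Finset.single_le_sum (f := fun i => |x i|) (fun j _ => abs_nonneg _) hi
    linarith

variable (t x) in
-- The factor with the logarithm and the added 1 lets one majorant, uniform in `s ≤ B`, serve for
-- the moments with and without a logarithm.
lemma abs_expMoment_le_exp {A B : ℝ} (hA1 : 1 ≤ A) (hA : ∀ i ∈ t, |x i| ≤ A) {p : ℕ} (hp : p ≤ 2)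
    {s : ℝ} (hs : 0 ≤ s) (hsB : s ≤ B) (ht : t.Nonempty) (w : ℝ) :
    |expMoment t x p s w| * (|Real.log (expMoment t x 0 s w)| + 1) ≤
      A ^ 2 * t.card * (Real.log t.card + A + B * A ^ 2 / 2 + 1) * Real.exp ((A + 1) * |w|) := by
  have hc : (1 : ℝ) ≤ t.card := by exact_mod_cast ht.card_pos
  have hlog : 0 ≤ Real.log t.card := Real.log_nonneg hc
  have hB : 0 ≤ B := hs.trans hsB
  have h1 := abs_expMoment_le hA p s w
  have h2 := expMoment_zero_le hA hs w
  have h3 := abs_log_expMoment_zero_le ht hA hs w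
  have h4 : A ^ p ≤ A ^ 2 := pow_le_pow_right₀ hA1 hp
  have h5 := abs_le_exp_abs w
  have h6 : 1 ≤ Real.exp |w| := Real.one_le_exp (abs_nonneg w)
  have h7 : |Real.log (expMoment t x 0 s w)| + 1 ≤
      (Real.log t.card + A + B * A ^ 2 / 2 + 1) * Real.exp |w| := by
    have e1 : Real.log t.card ≤ Real.log t.card * Real.exp |w| := le_mul_of_one_le_right hlog h6
    have e2 : A * |w| ≤ A * Real.exp |w| := by gcongr
    have e3 : s * A ^ 2 / 2 ≤ B * A ^ 2 / 2 * Real.exp |w| :=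
      le_trans (by gcongr) (le_mul_of_one_le_right (by positivity) h6)
    linarith
  have h8 : |expMoment t x p s w| ≤ A ^ 2 * (t.card * Real.exp (A * |w|)) :=
    h1.trans (mul_le_mul h4 h2 (expMoment_zero_pos ht _ _).le (by positivity))
  calc _ ≤ (A ^ 2 * (t.card * Real.exp (A * |w|))) *
      ((Real.log t.card + A + B * A ^ 2 / 2 + 1) * Real.exp |w|) := by gcongr
    _ = _ := by
      rw [add_mul A 1, one_mul, Real.exp_add]; ring

variable (t x) in
/-- The entropy of the weights relative to a Gaussian of variance `s`. -/
def gaussianEntropy (s : ℝ) : ℝ :=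
  ∫ z, expMoment t x 0 s (√s * z) * Real.log (expMoment t x 0 s (√s * z)) ∂(gaussianReal 0 1)

variable (t x) in
/-- The mean square of the conditional mean. -/
def meanSqCondMean (s : ℝ) : ℝ :=
  ∫ z, expMoment t x 1 s (√s * z) ^ 2 / expMoment t x 0 s (√s * z) ∂(gaussianReal 0 1)

lemma continuous_expMoment_right (t : Finset ι) (x : ι → ℝ) (p : ℕ) (s : ℝ) :
    Continuous (expMoment t x p s) := by
  unfold expMoment; fun_prop

/-- For a backward heat solution `u`, the generator applied to `u log u` leaves only `(∂u)² / (2u)`,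
because the terms with the logarithm cancel. Here `∂u` is the first moment. -/
theorem hasDerivAt_gaussianEntropy (ht : t.Nonempty) {s : ℝ} (hs : 0 < s) :
    HasDerivAt (gaussianEntropy t x) (1 / 2 * meanSqCondMean t x s) s := by
  have hpos := expMoment_zero_pos (x := x) ht
  have hc := continuous_expMoment_right t x
  have hclog : ∀ s, Continuous fun w => Real.log (expMoment t x 0 s w) := fun s =>
    (hc 0 s).log fun w => (hpos s w).ne'
  have := hasDerivAt_integral_gaussian_sqrt
    (F := fun s w => expMoment t x 0 s w * Real.log (expMoment t x 0 s w))
    (Fs := fun s w => -(1 / 2) * expMoment t x 2 s w * (Real.log (expMoment t x 0 s w) + 1))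
    (Fw := fun s w => expMoment t x 1 s w * (Real.log (expMoment t x 0 s w) + 1))
    (Fww := fun s w => expMoment t x 2 s w * (Real.log (expMoment t x 0 s w) + 1) +
      expMoment t x 1 s w ^ 2 / expMoment t x 0 s w)
    (fun s hs z => by
      have h := hasDerivAt_expMoment_sqrt t x 0 hs z
      have hp := hpos s (√s * z)
      refine (h.mul (h.log hp.ne')).congr_deriv ?_
      simp only [zero_add]
      generalize √s * z = w at hp ⊢
      field_simp
      ring)
    (fun s hs w => by
      have h0 := hasDerivAt_expMoment t x 0 s w
      have h1 := hasDerivAt_expMoment t x 1 s w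
      have hp := hpos s w
      refine (h1.mul ((h0.log hp.ne').add_const 1)).congr_deriv ?_
      field_simp)
    (fun s _ => (hc 0 s).mul (hclog s))
    (fun s _ => ((hc 2 s).const_mul _).mul ((hclog s).add continuous_const))
    (fun s _ => ((hc 2 s).mul ((hclog s).add continuous_const)).add
      (((hc 1 s).pow 2).div (hc 0 s) fun w => (hpos s w).ne'))
    (fun B => by
      obtain ⟨A, hA1, hA⟩ := exists_abs_le_of_finset t x
      refine ⟨2 * (A ^ 2 * t.card * (Real.log t.card + A + B * A ^ 2 / 2 + 1)), A + 1,
        by linarith, fun s hs hsB w => ?_⟩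
      have hl : 0 ≤ |Real.log (expMoment t x 0 s w)| := abs_nonneg _
      have ha := abs_add_le (Real.log (expMoment t x 0 s w)) 1
      rw [abs_one] at ha
      have k0 := abs_expMoment_le_exp t x hA1 hA (p := 0) (by norm_num) hs.le hsB ht w
      have k1 := abs_expMoment_le_exp t x hA1 hA (p := 1) (by norm_num) hs.le hsB ht w
      have k2 := abs_expMoment_le_exp t x hA1 hA (p := 2) (by norm_num) hs.le hsB ht w
      set R := A ^ 2 * t.card * (Real.log t.card + A + B * A ^ 2 / 2 + 1) *
        Real.exp ((A + 1) * |w|) with hR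
      have hR0 : 0 ≤ R := le_trans (by positivity) k0
      have hR2 : 2 * (A ^ 2 * t.card * (Real.log t.card + A + B * A ^ 2 / 2 + 1)) *
        Real.exp ((A + 1) * |w|) = 2 * R := by rw [hR]; ring
      rw [hR2]
      have m2 : |expMoment t x 2 s w * (Real.log (expMoment t x 0 s w) + 1)| ≤ R := by
        rw [abs_mul]
        exact (mul_le_mul_of_nonneg_left ha (abs_nonneg _)).trans k2
      refine ⟨?_, ?_, ?_, ?_⟩
      · rw [abs_mul]
        have : |expMoment t x 0 s w| * |Real.log (expMoment t x 0 s w)| ≤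
          |expMoment t x 0 s w| * (|Real.log (expMoment t x 0 s w)| + 1) := by gcongr; linarith
        linarith
      · rw [mul_assoc, abs_mul, abs_neg, abs_of_pos one_half_pos]
        linarith
      · rw [abs_mul]
        have := mul_le_mul_of_nonneg_left ha (abs_nonneg (expMoment t x 1 s w))
        linarith
      · refine (abs_add_le _ _).trans ?_
        have hp := hpos s w
        have h1 := abs_expMoment_le hA 1 s w
        have : |expMoment t x 1 s w ^ 2 / expMoment t x 0 s w| ≤ R := by
          rw [abs_div, abs_pow, abs_of_pos hp, div_le_iff₀ hp, sq]
          calc |expMoment t x 1 s w| * |expMoment t x 1 s w|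
              ≤ (A ^ 1 * expMoment t x 0 s w) * (A ^ 1 * expMoment t x 0 s w) := by gcongr
            _ = A ^ 2 * expMoment t x 0 s w * expMoment t x 0 s w := by ring
            _ ≤ R * expMoment t x 0 s w := by
              gcongr
              have hz := expMoment_zero_le hA hs.le w
              refine (mul_le_mul_of_nonneg_left hz (by positivity)).trans ?_
              rw [hR, ← mul_assoc]
              have hc1 : (1 : ℝ) ≤ t.card := by exact_mod_cast ht.card_pos
              have hlog : 0 ≤ Real.log t.card := Real.log_nonneg hc1
              have hB : 0 ≤ B := hs.le.trans hsB
              have : 0 ≤ B * A ^ 2 / 2 := by positivity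
              exact mul_le_mul (le_mul_of_one_le_right (by positivity) (by linarith))
                (Real.exp_le_exp.2 (by gcongr; linarith)) (Real.exp_pos _).le (by positivity)
        linarith) hs
  refine this.congr_deriv ?_
  rw [meanSqCondMean, ← integral_const_mul]
  congr 1 with z
  ring

/-- Applied to `a² / u` with backward heat solutions `a` and `u`, the generator leaves `(∂a - (a/u)
∂u)² / u`. For the first and zeroth moments this is the weight times the squared variance, and the
third moments cancel. -/
theorem hasDerivAt_meanSqCondMean (ht : t.Nonempty) {s : ℝ} (hs : 0 < s) :
    HasDerivAt (meanSqCondMean t x) (∫ z, expMoment t x 0 s (√s * z) * expVar t x s (√s * z) ^ 2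
      ∂(gaussianReal 0 1)) s := by
  have hpos := expMoment_zero_pos (x := x) ht
  have hc := continuous_expMoment_right t x
  set m : ℕ → ℝ → ℝ → ℝ := fun p s w => expMoment t x p s w / expMoment t x 0 s w with hm
  have hcm : ∀ p s, Continuous (m p s) := fun p s => (hc p s).div (hc 0 s) fun w => (hpos s w).ne'
  have hdm : ∀ p s w, HasDerivAt (m p s) (m (p + 1) s w - m 1 s w * m p s w) w := by
    intro p s w
    have hp := (hpos s w).ne'
    refine ((hasDerivAt_expMoment t x p s w).div (hasDerivAt_expMoment t x 0 s w) hp).congr_deriv ?_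
    simp only [hm]
    field_simp
  have := hasDerivAt_integral_gaussian_sqrt
    (F := fun s w => expMoment t x 1 s w ^ 2 / expMoment t x 0 s w)
    (Fs := fun s w => expMoment t x 0 s w *
      (1 / 2 * m 1 s w ^ 2 * m 2 s w - m 1 s w * m 3 s w))
    (Fw := fun s w => expMoment t x 0 s w * (2 * m 1 s w * m 2 s w - m 1 s w ^ 3))
    (Fww := fun s w => expMoment t x 0 s w * (2 * m 2 s w ^ 2 + 2 * m 1 s w * m 3 s w -
      5 * m 1 s w ^ 2 * m 2 s w + 2 * m 1 s w ^ 4))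
    (fun s hs z => by
      have h0 := hasDerivAt_expMoment_sqrt t x 0 hs z
      have h1 := hasDerivAt_expMoment_sqrt t x 1 hs z
      have hp := (hpos s (√s * z)).ne'
      refine ((h1.pow 2).div h0 hp).congr_deriv ?_
      have hq := (Real.sqrt_pos.2 hs).ne'
      simp only [hm, Pi.pow_apply]
      field_simp
      push_cast
      ring)
    (fun s hs w => by
      have h0 := hasDerivAt_expMoment t x 0 s w
      have hp := (hpos s w).ne'
      refine (h0.mul ((((hdm 1 s w).const_mul 2).mul (hdm 2 s w)).sub
        ((hdm 1 s w).pow 3))).congr_deriv ?_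
      have e : expMoment t x 1 s w = expMoment t x 0 s w * m 1 s w := by
        simp only [hm]; field_simp
      simp only [zero_add, e, Pi.sub_apply, Pi.mul_apply, Pi.pow_apply]
      norm_num
      ring)
    (fun s _ => ((hc 1 s).pow 2).div (hc 0 s) fun w => (hpos s w).ne')
    (fun s _ => by
      have := hc 0 s; have := hcm 1 s; have := hcm 2 s; have := hcm 3 s
      fun_prop)
    (fun s _ => by
      have := hc 0 s; have := hcm 1 s; have := hcm 2 s; have := hcm 3 s
      fun_prop)
    (fun B => by
      obtain ⟨A, hA1, hA⟩ := exists_abs_le_of_finset t x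
      -- 11 is the sum of the absolute coefficients `2 + 2 + 5 + 2` in `Fww`, the largest of the
      -- four functions to be bounded.
      refine ⟨11 * A ^ 4 * t.card, A, by linarith, fun s hs hsB w => ?_⟩
      have hp := hpos s w
      have hmb : ∀ p, |m p s w| ≤ A ^ p := by
        intro p
        simp only [hm]
        rw [abs_div, abs_of_pos hp, div_le_iff₀ hp]
        exact abs_expMoment_le hA p s w
      have hz := expMoment_zero_le hA hs.le w
      have hA2 : A ^ 2 ≤ A ^ 4 := pow_le_pow_right₀ hA1 (by norm_num)
      have hA3 : A ^ 3 ≤ A ^ 4 := pow_le_pow_right₀ hA1 (by norm_num)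
      have hA4 : 0 ≤ A ^ 4 := by positivity
      have hmul : ∀ {r : ℝ}, |r| ≤ 11 * A ^ 4 →
          |expMoment t x 0 s w * r| ≤ 11 * A ^ 4 * t.card * Real.exp (A * |w|) := by
        intro r hr
        rw [abs_mul, abs_of_pos hp, mul_comm, mul_assoc]
        exact mul_le_mul hr hz hp.le (by positivity)
      have hprod : ∀ p q, |m p s w * m q s w| ≤ A ^ (p + q) := fun p q => by
        rw [abs_mul, pow_add]
        exact mul_le_mul (hmb p) (hmb q) (abs_nonneg _) (by positivity)
      have hpow : ∀ k, |m 1 s w ^ k| ≤ A ^ k := fun k => by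
        rw [abs_pow]
        exact pow_le_pow_left₀ (abs_nonneg _) (by simpa using hmb 1) k
      have b13 := abs_le.1 (hprod 1 3)
      have b12 := abs_le.1 (hprod 1 2)
      have b22 := abs_le.1 (hprod 2 2)
      have b1 := abs_le.1 (hpow 2)
      have b3 := abs_le.1 (hpow 3)
      have b4 := abs_le.1 (hpow 4)
      have b112 : |m 1 s w ^ 2 * m 2 s w| ≤ A ^ 4 := by
        rw [abs_mul, show A ^ 4 = A ^ 2 * A ^ 2 by ring]
        exact mul_le_mul (hpow 2) (hmb 2) (abs_nonneg _) (by positivity)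
      have b112 := abs_le.1 b112
      norm_num at b13 b12 b22
      refine ⟨?_, hmul ?_, hmul ?_, hmul ?_⟩
      · have e : expMoment t x 1 s w ^ 2 / expMoment t x 0 s w =
            expMoment t x 0 s w * m 1 s w ^ 2 := by
          simp only [hm]; field_simp
        rw [e]
        refine hmul (abs_le.2 ⟨?_, ?_⟩) <;> linarith
      all_goals
        rw [abs_le]
        constructor <;> nlinarith) hs
  refine this.congr_deriv ?_
  congr 1 with z
  have hp := (hpos s (√s * z)).ne'
  simp only [hm, expVar]
  field_simp
  ring

end ExpMoment

/-! ### Concavity in the log-SNR from the variance inequality. -/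

section Concavity

variable {ι : Type*} {t : Finset ι} {x : ι → ℝ}

lemma integral_exp_mul_sqrt_sub (a : ℝ) {s : ℝ} (hs : 0 ≤ s) :
    Integrable (fun z => Real.exp (a * (√s * z) - s * a ^ 2 / 2)) (gaussianReal 0 1) ∧
    ∫ z, Real.exp (a * (√s * z) - s * a ^ 2 / 2) ∂(gaussianReal 0 1) = 1 := by
  have e : ∀ z, Real.exp (a * (√s * z) - s * a ^ 2 / 2) =
      Real.exp (-(s * a ^ 2 / 2)) * Real.exp ((a * √s) * z) := fun z => by
    rw [← Real.exp_add]; congr 1; ring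
  simp only [e]
  refine ⟨(integrable_exp_mul_gaussianReal _).const_mul _, ?_⟩
  have hm := congrFun (mgf_fun_id_gaussianReal (μ := 0) (v := 1)) (a * √s)
  rw [mgf] at hm
  rw [integral_const_mul, hm, ← Real.exp_add]
  have : (a * √s) ^ 2 = s * a ^ 2 := by rw [mul_pow, Real.sq_sqrt hs]; ring
  rw [← Real.exp_zero]
  congr 1
  push_cast
  rw [this]
  ring

lemma integral_expMoment_sqrt (t : Finset ι) (x : ι → ℝ) (p : ℕ) {s : ℝ} (hs : 0 ≤ s) :
    Integrable (fun z => expMoment t x p s (√s * z)) (gaussianReal 0 1) ∧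
    ∫ z, expMoment t x p s (√s * z) ∂(gaussianReal 0 1) = ∑ i ∈ t, x i ^ p := by
  unfold expMoment
  have hi := fun i => (integral_exp_mul_sqrt_sub (x i) hs).1.const_mul (x i ^ p)
  refine ⟨integrable_finsetSum _ fun i _ => hi i, ?_⟩
  rw [integral_finsetSum _ fun i _ => hi i]
  refine Finset.sum_congr rfl fun i _ => ?_
  rw [integral_const_mul, (integral_exp_mul_sqrt_sub (x i) hs).2, mul_one]

/-- The law of total variance: the mean conditional variance is the second moment minus the mean
square of the conditional mean. -/
lemma integral_mul_expVar (ht : t.Nonempty) {s : ℝ} (hs : 0 ≤ s) :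
    ∫ z, expMoment t x 0 s (√s * z) * expVar t x s (√s * z) ∂(gaussianReal 0 1) =
      ∑ i ∈ t, x i ^ 2 - meanSqCondMean t x s := by
  have hpos := expMoment_zero_pos (x := x) ht
  have hc := continuous_expMoment_right t x
  obtain ⟨A, hA1, hA⟩ := exists_abs_le_of_finset t x
  obtain ⟨i2, e2⟩ := integral_expMoment_sqrt t x 2 hs
  obtain ⟨i0, -⟩ := integral_expMoment_sqrt t x 0 hs
  have i1 : Integrable (fun z => expMoment t x 1 s (√s * z) ^ 2 / expMoment t x 0 s (√s * z))
      (gaussianReal 0 1) := by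
    refine (i0.const_mul (A ^ 2)).mono' ?_ (Filter.Eventually.of_forall fun z => ?_)
    · have : Continuous fun w => expMoment t x 1 s w ^ 2 / expMoment t x 0 s w :=
        ((hc 1 s).pow 2).div (hc 0 s) fun w => (hpos s w).ne'
      exact (this.comp (by fun_prop : Continuous fun z => √s * z)).aestronglyMeasurable
    · have hp := hpos s (√s * z)
      have h1 := abs_expMoment_le hA 1 s (√s * z)
      rw [Real.norm_eq_abs, abs_div, abs_pow, abs_of_pos hp, div_le_iff₀ hp, mul_assoc, ← sq,
        ← mul_pow]
      rw [pow_one] at h1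
      exact pow_le_pow_left₀ (abs_nonneg _) h1 2
  rw [meanSqCondMean, ← e2, ← integral_sub i2 i1]
  congr 1 with z
  have hp := (hpos s (√s * z)).ne'
  simp only [expVar]
  field_simp

/-- Completing the square. The factor `e^{z²/2}` cancels the Gaussian density, so Gaussian
expectations become Lebesgue integrals of lattice Gaussians with `b = √s`. -/
lemma expMoment_lattice (c d : ℝ) (m p : ℕ) {s : ℝ} (hs : 0 ≤ s) (z : ℝ) :
    expMoment (Finset.range (m + 1)) (fun k : ℕ => ((k : ℝ) - c) * d) p s (√s * z) =
      Real.exp (z ^ 2 / 2) *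
        ∑ k ∈ Finset.range (m + 1), (((k : ℝ) - c) * d) ^ p * latticeGaussian √s c d z k := by
  unfold expMoment latticeGaussian
  rw [Finset.mul_sum]
  refine Finset.sum_congr rfl fun k _ => ?_
  rw [mul_left_comm (Real.exp _), ← Real.exp_add]
  congr 2
  linear_combination ((k - c) * d) ^ 2 / 2 * (Real.sq_sqrt hs)

lemma expVar_lattice (c d : ℝ) (m : ℕ) {s : ℝ} (hs : 0 ≤ s) (z : ℝ) :
    expVar (Finset.range (m + 1)) (fun k : ℕ => ((k : ℝ) - c) * d) s (√s * z) =
      d ^ 2 * indexVar (latticeGaussian √s c d z) (m + 1) := by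
  unfold expVar indexVar
  rw [expMoment_lattice c d m 0 hs, expMoment_lattice c d m 1 hs, expMoment_lattice c d m 2 hs]
  have hW := sum_range_pos (latticeGaussian_pos √s c d z) m
  set g := latticeGaussian √s c d z
  have h1 : ∑ k ∈ Finset.range (m + 1), (((k : ℝ) - c) * d) ^ 1 * g k =
      d * (∑ k ∈ Finset.range (m + 1), (k : ℝ) * g k) -
        c * d * ∑ k ∈ Finset.range (m + 1), g k := by
    rw [Finset.mul_sum, Finset.mul_sum, ← Finset.sum_sub_distrib]
    exact Finset.sum_congr rfl fun k _ => by ring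
  have h2 : ∑ k ∈ Finset.range (m + 1), (((k : ℝ) - c) * d) ^ 2 * g k =
      d ^ 2 * (∑ k ∈ Finset.range (m + 1), (k : ℝ) ^ 2 * g k) -
        2 * c * d ^ 2 * (∑ k ∈ Finset.range (m + 1), (k : ℝ) * g k) +
        c ^ 2 * d ^ 2 * ∑ k ∈ Finset.range (m + 1), g k := by
    rw [Finset.mul_sum, Finset.mul_sum, Finset.mul_sum, ← Finset.sum_sub_distrib,
      ← Finset.sum_add_distrib]
    exact Finset.sum_congr rfl fun k _ => by ring
  simp only [pow_zero, one_mul]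
  rw [h1, h2]
  have := (Real.exp_pos (z ^ 2 / 2)).ne'
  field_simp
  ring

theorem integral_expVar_le {d : ℝ} (hd : 0 < d) (c : ℝ) (m : ℕ) {s : ℝ} (hs : 0 < s)
    (h : 8 ≤ s * d ^ 2) :
    ∫ z, expMoment (Finset.range (m + 1)) (fun k : ℕ => ((k : ℝ) - c) * d) 0 s (√s * z) *
      expVar (Finset.range (m + 1)) (fun k : ℕ => ((k : ℝ) - c) * d) s (√s * z)
      ∂(gaussianReal 0 1) ≤
    s * ∫ z, expMoment (Finset.range (m + 1)) (fun k : ℕ => ((k : ℝ) - c) * d) 0 s (√s * z) *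
      expVar (Finset.range (m + 1)) (fun k : ℕ => ((k : ℝ) - c) * d) s (√s * z) ^ 2
      ∂(gaussianReal 0 1) := by
  have hb : (√s * d) ^ 2 = s * d ^ 2 := by rw [mul_pow, Real.sq_sqrt hs.le]
  have key := integral_indexVar_le (Real.sqrt_pos.2 hs) hd (by rw [hb]; exact h) c m
  rw [hb] at key
  rw [integral_gaussianReal_eq_integral_smul one_ne_zero,
    integral_gaussianReal_eq_integral_smul one_ne_zero]
  have hexp : ∀ z : ℝ, Real.exp (-z ^ 2 / 2) * Real.exp (z ^ 2 / 2) = 1 := fun z => by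
    rw [← Real.exp_add, ← Real.exp_zero]; congr 1; ring
  have e : ∀ (z : ℝ) (p : ℕ), gaussianPDFReal 0 1 z •
      (expMoment (Finset.range (m + 1)) (fun k : ℕ => ((k : ℝ) - c) * d) 0 s (√s * z) *
      expVar (Finset.range (m + 1)) (fun k : ℕ => ((k : ℝ) - c) * d) s (√s * z) ^ p) =
      (√(2 * Real.pi))⁻¹ * (d ^ 2) ^ p *
        ((∑ k ∈ Finset.range (m + 1), latticeGaussian √s c d z k) *
          indexVar (latticeGaussian √s c d z) (m + 1) ^ p) := by
    intro z p
    rw [expVar_lattice c d m hs.le, expMoment_lattice c d m 0 hs.le, gaussianPDFReal_zero_one,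
      smul_eq_mul]
    simp only [pow_zero, one_mul]
    linear_combination ((√(2 * Real.pi))⁻¹ * (d ^ 2) ^ p *
        ((∑ k ∈ Finset.range (m + 1), latticeGaussian √s c d z k) *
          indexVar (latticeGaussian √s c d z) (m + 1) ^ p)) * hexp z
  have e1 := fun z => e z 1
  simp only [pow_one] at e1
  simp only [e, e1]
  rw [integral_const_mul, integral_const_mul]
  have := mul_le_mul_of_nonneg_left key (by positivity : 0 ≤ (√(2 * Real.pi))⁻¹ * d ^ 2)
  refine this.trans (le_of_eq (by ring))

/-- The second derivative is `e^ζ` times the difference of the mean variance and `2 e^ζ` times the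
mean squared variance. The argument `2 (e^ζ - 1)` is the SNR per real coordinate, whose noise
variance is 1/2, so the hypothesis is `8 ≤ s d²`. -/
theorem concaveOn_sub_gaussianEntropy {d : ℝ} (hd : 0 < d) (c : ℝ) (m : ℕ) {ζ₁ : ℝ}
    (h : 4 ≤ d ^ 2 * (Real.exp ζ₁ - 1)) :
    ConcaveOn ℝ (Set.Ici ζ₁) fun ζ => (Real.exp ζ - 1) *
      ∑ k ∈ Finset.range (m + 1), (((k : ℝ) - c) * d) ^ 2 -
        gaussianEntropy (Finset.range (m + 1)) (fun k : ℕ => ((k : ℝ) - c) * d)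
          (2 * (Real.exp ζ - 1)) := by
  set t := Finset.range (m + 1)
  set x : ℕ → ℝ := fun k : ℕ => ((k : ℝ) - c) * d
  have ht : t.Nonempty := ⟨0, by simp [t]⟩
  set P := ∑ k ∈ t, x k ^ 2
  have hge : ∀ ζ, ζ₁ ≤ ζ → 4 ≤ d ^ 2 * (Real.exp ζ - 1) := fun ζ hζ =>
    h.trans (by gcongr)
  have hpos : ∀ ζ, ζ₁ ≤ ζ → 0 < 2 * (Real.exp ζ - 1) := fun ζ hζ => by
    have := hge ζ hζ
    have h1 : 0 < d ^ 2 * (Real.exp ζ - 1) := by linarith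
    have := pos_of_mul_pos_right h1 (by positivity)
    linarith
  have hs : ∀ ζ, HasDerivAt (fun ζ => 2 * (Real.exp ζ - 1)) (2 * Real.exp ζ) ζ := fun ζ =>
    ((Real.hasDerivAt_exp ζ).sub_const 1).const_mul 2
  have d1 : ∀ ζ, ζ₁ ≤ ζ → HasDerivAt (fun ζ => (Real.exp ζ - 1) * P -
      gaussianEntropy t x (2 * (Real.exp ζ - 1)))
      (Real.exp ζ * (P - meanSqCondMean t x (2 * (Real.exp ζ - 1)))) ζ := fun ζ hζ => by
    have h1 := (hasDerivAt_gaussianEntropy (x := x) ht (hpos ζ hζ)).comp ζ (hs ζ)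
    exact ((((Real.hasDerivAt_exp ζ).sub_const 1).mul_const P).sub h1).congr_deriv (by ring)
  have d2 : ∀ ζ, ζ₁ ≤ ζ → HasDerivAt (fun ζ => Real.exp ζ *
      (P - meanSqCondMean t x (2 * (Real.exp ζ - 1)))) (Real.exp ζ *
      (P - meanSqCondMean t x (2 * (Real.exp ζ - 1))) - Real.exp ζ *
      ((∫ z, expMoment t x 0 (2 * (Real.exp ζ - 1)) (√(2 * (Real.exp ζ - 1)) * z) *
        expVar t x (2 * (Real.exp ζ - 1)) (√(2 * (Real.exp ζ - 1)) * z) ^ 2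
      ∂(gaussianReal 0 1)) * (2 * Real.exp ζ))) ζ := fun ζ hζ => by
    have h1 := (hasDerivAt_meanSqCondMean (x := x) ht (hpos ζ hζ)).comp ζ (hs ζ)
    exact ((Real.hasDerivAt_exp ζ).mul (h1.const_sub P)).congr_deriv (by
      simp only [Function.comp]; ring)
  have hint : ∀ ζ, ζ ∈ interior (Set.Ici ζ₁) → ζ₁ ≤ ζ := fun ζ hζ => interior_subset hζ
  refine concaveOn_of_hasDerivWithinAt2_nonpos (convex_Ici ζ₁)
    (fun ζ hζ => (d1 ζ hζ).continuousAt.continuousWithinAt)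
    (fun ζ hζ => (d1 ζ (hint ζ hζ)).hasDerivWithinAt)
    (fun ζ hζ => (d2 ζ (hint ζ hζ)).hasDerivWithinAt) fun ζ hζ => ?_
  have hζ := hint ζ hζ
  have hsp := hpos ζ hζ
  have hs8 : 8 ≤ 2 * (Real.exp ζ - 1) * d ^ 2 := by linarith [hge ζ hζ]
  have key := integral_expVar_le hd c m hsp hs8
  have e := integral_mul_expVar (x := x) ht hsp.le
  change ∫ z, expMoment t x 0 (2 * (Real.exp ζ - 1)) (√(2 * (Real.exp ζ - 1)) * z) *
    expVar t x (2 * (Real.exp ζ - 1)) (√(2 * (Real.exp ζ - 1)) * z) ∂(gaussianReal 0 1) ≤ _ at key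
  rw [e] at key
  set L := ∫ z, expMoment t x 0 (2 * (Real.exp ζ - 1)) (√(2 * (Real.exp ζ - 1)) * z) *
        expVar t x (2 * (Real.exp ζ - 1)) (√(2 * (Real.exp ζ - 1)) * z) ^ 2 ∂(gaussianReal 0 1)
    with hL
  have hL0 : 0 ≤ L := integral_nonneg fun z =>
    mul_nonneg (expMoment_zero_pos ht _ _).le (sq_nonneg _)
  have hE := Real.exp_pos ζ
  rw [← mul_sub]
  refine mul_nonpos_of_nonneg_of_nonpos hE.le ?_
  have : P - meanSqCondMean t x (2 * (Real.exp ζ - 1)) ≤ 2 * (Real.exp ζ - 1) * L := key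
  -- The factor available is `2 e^ζ`, which exceeds `s = 2 (e^ζ - 1)`; since `L ≥ 0` the excess only
  -- helps.
  nlinarith

end Concavity

/-! ### Densities of shifted Gaussian noise. -/

section ShiftDensity

/-- The density of `N(a, 1/2)` with respect to `N(0, 1/2)`. -/
def shiftDensityReal (a z : ℝ) : ℝ := Real.exp (2 * a * z - a ^ 2)

/-- The density of a standard complex Gaussian shifted by `c` with respect to the unshifted one. -/
def shiftDensity (c n : ℂ) : ℝ := shiftDensityReal c.re n.re * shiftDensityReal c.im n.im

lemma shiftDensityReal_pos (a z : ℝ) : 0 < shiftDensityReal a z := Real.exp_pos _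

lemma shiftDensity_pos (c n : ℂ) : 0 < shiftDensity c n :=
  mul_pos (shiftDensityReal_pos _ _) (shiftDensityReal_pos _ _)

lemma log_shiftDensityReal (a z : ℝ) : Real.log (shiftDensityReal a z) = 2 * a * z - a ^ 2 :=
  Real.log_exp _

lemma log_shiftDensity (c n : ℂ) : Real.log (shiftDensity c n) =
    (2 * c.re * n.re - c.re ^ 2) + (2 * c.im * n.im - c.im ^ 2) := by
  rw [shiftDensity, Real.log_mul (shiftDensityReal_pos _ _).ne' (shiftDensityReal_pos _ _).ne',
    log_shiftDensityReal, log_shiftDensityReal]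

@[fun_prop]
lemma measurable_shiftDensityReal (a : ℝ) : Measurable (shiftDensityReal a) := by
  unfold shiftDensityReal; fun_prop

lemma measurable_uncurry_shiftDensity : Measurable fun p : ℂ × ℂ => shiftDensity p.1 p.2 := by
  unfold shiftDensity shiftDensityReal
  fun_prop

@[fun_prop]
lemma measurable_shiftDensity (c : ℂ) : Measurable (shiftDensity c) :=
  measurable_uncurry_shiftDensity.comp measurable_prodMk_left

lemma gaussianReal_half_eq_withDensity (a : ℝ) : gaussianReal a (1 / 2) =
    (gaussianReal 0 (1 / 2)).withDensity fun z => ENNReal.ofReal (shiftDensityReal a z) := by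
  have h0 : (1 / 2 : NNReal) ≠ 0 := by norm_num
  rw [gaussianReal_of_var_ne_zero _ h0, gaussianReal_of_var_ne_zero _ h0,
    ← withDensity_mul _ (measurable_gaussianPDF _ _)
      (measurable_shiftDensityReal a).ennreal_ofReal]
  congr 1 with z
  rw [Pi.mul_apply, gaussianPDF, gaussianPDF, ← ENNReal.ofReal_mul (gaussianPDFReal_nonneg _ _ _)]
  congr 1
  rw [gaussianPDFReal, gaussianPDFReal, shiftDensityReal, mul_assoc _ (Real.exp _) (Real.exp _),
    ← Real.exp_add]
  congr 2
  push_cast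
  ring

lemma integral_mul_shiftDensityReal (a : ℝ) (f : ℝ → ℝ) :
    ∫ z, shiftDensityReal a z * f z ∂(gaussianReal 0 (1 / 2)) =
      ∫ z, f z ∂(gaussianReal a (1 / 2)) := by
  rw [gaussianReal_half_eq_withDensity a, integral_withDensity_eq_integral_toReal_smul
    (by fun_prop) (Filter.Eventually.of_forall fun z => ENNReal.ofReal_lt_top)]
  congr 1 with z
  rw [ENNReal.toReal_ofReal (shiftDensityReal_pos _ _).le, smul_eq_mul]

lemma integrable_mul_shiftDensityReal (a : ℝ) {f : ℝ → ℝ}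
    (hf : Integrable f (gaussianReal a (1 / 2))) :
    Integrable (fun z => shiftDensityReal a z * f z) (gaussianReal 0 (1 / 2)) := by
  rw [gaussianReal_half_eq_withDensity a, integrable_withDensity_iff_integrable_smul'
    (by fun_prop) (Filter.Eventually.of_forall fun z => ENNReal.ofReal_lt_top)] at hf
  refine hf.congr (Filter.Eventually.of_forall fun z => ?_)
  simp only [ENNReal.toReal_ofReal (shiftDensityReal_pos _ _).le, smul_eq_mul]

lemma integrable_shiftDensityReal (a : ℝ) :
    Integrable (shiftDensityReal a) (gaussianReal 0 (1 / 2)) := by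
  simpa using integrable_mul_shiftDensityReal a (f := fun _ => 1) (integrable_const _)

lemma integral_shiftDensityReal (a : ℝ) :
    ∫ z, shiftDensityReal a z ∂(gaussianReal 0 (1 / 2)) = 1 := by
  simpa using integral_mul_shiftDensityReal a (fun _ => 1)

lemma integrable_id_gaussianReal (m : ℝ) (v : NNReal) :
    Integrable (fun z : ℝ => z) (gaussianReal m v) :=
  (memLp_id_gaussianReal (μ := m) (v := v) 1).integrable (by norm_num)

lemma integrable_shiftDensityReal_mul_log (a : ℝ) :
    Integrable (fun z => shiftDensityReal a z * (2 * a * z - a ^ 2)) (gaussianReal 0 (1 / 2)) :=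
  integrable_mul_shiftDensityReal a
    (((integrable_id_gaussianReal _ _).const_mul _).sub (integrable_const _))

lemma integral_shiftDensityReal_mul_log (a : ℝ) :
    ∫ z, shiftDensityReal a z * (2 * a * z - a ^ 2) ∂(gaussianReal 0 (1 / 2)) = a ^ 2 := by
  rw [integral_mul_shiftDensityReal, integral_sub
    ((integrable_id_gaussianReal _ _).const_mul _) (integrable_const _), integral_const_mul,
    integral_id_gaussianReal]
  simp
  ring

lemma integral_stdComplexGaussian {f : ℂ → ℝ} (hf : Measurable f) :
    ∫ n, f n ∂stdComplexGaussian =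
      ∫ p : ℝ × ℝ, f ⟨p.1, p.2⟩ ∂((gaussianReal 0 (1 / 2)).prod (gaussianReal 0 (1 / 2))) :=
  integral_map measurable_complex_mk.aemeasurable hf.aestronglyMeasurable

lemma integrable_stdComplexGaussian_iff {f : ℂ → ℝ} (hf : Measurable f) :
    Integrable f stdComplexGaussian ↔ Integrable (fun p : ℝ × ℝ => f ⟨p.1, p.2⟩)
      ((gaussianReal 0 (1 / 2)).prod (gaussianReal 0 (1 / 2))) :=
  integrable_map_measure hf.aestronglyMeasurable measurable_complex_mk.aemeasurable

lemma integrable_shiftDensity (c : ℂ) : Integrable (shiftDensity c) stdComplexGaussian := by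
  rw [integrable_stdComplexGaussian_iff (by fun_prop)]
  exact (integrable_shiftDensityReal c.re).mul_prod (integrable_shiftDensityReal c.im)

lemma integral_shiftDensity (c : ℂ) : ∫ n, shiftDensity c n ∂stdComplexGaussian = 1 := by
  rw [integral_stdComplexGaussian (by fun_prop)]
  simp only [shiftDensity]
  rw [integral_prod_mul, integral_shiftDensityReal, integral_shiftDensityReal, one_mul]

lemma shiftDensity_mul_log_mk (c : ℂ) (p : ℝ × ℝ) :
    shiftDensity c ⟨p.1, p.2⟩ * Real.log (shiftDensity c ⟨p.1, p.2⟩) =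
      (shiftDensityReal c.re p.1 * (2 * c.re * p.1 - c.re ^ 2)) * shiftDensityReal c.im p.2 +
      shiftDensityReal c.re p.1 * (shiftDensityReal c.im p.2 * (2 * c.im * p.2 - c.im ^ 2)) := by
  rw [log_shiftDensity, shiftDensity]
  ring

lemma integrable_shiftDensity_mul_log (c : ℂ) :
    Integrable (fun n => shiftDensity c n * Real.log (shiftDensity c n)) stdComplexGaussian := by
  rw [integrable_stdComplexGaussian_iff (by fun_prop)]
  simp only [shiftDensity_mul_log_mk]
  exact ((integrable_shiftDensityReal_mul_log c.re).mul_prod (integrable_shiftDensityReal c.im)).add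
    ((integrable_shiftDensityReal c.re).mul_prod (integrable_shiftDensityReal_mul_log c.im))

/-- The relative entropy of the noise shifted by `c` with respect to the noise; it produces the term
linear in `γ` of the mutual information. -/
lemma integral_shiftDensity_mul_log (c : ℂ) :
    ∫ n, shiftDensity c n * Real.log (shiftDensity c n) ∂stdComplexGaussian =
      c.re ^ 2 + c.im ^ 2 := by
  rw [integral_stdComplexGaussian (by fun_prop)]
  simp only [shiftDensity_mul_log_mk]
  rw [integral_add
    ((integrable_shiftDensityReal_mul_log c.re).mul_prod (integrable_shiftDensityReal c.im))
    ((integrable_shiftDensityReal c.re).mul_prod (integrable_shiftDensityReal_mul_log c.im)),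
    integral_prod_mul (fun z => shiftDensityReal c.re z * (2 * c.re * z - c.re ^ 2))
      (shiftDensityReal c.im),
    integral_prod_mul (shiftDensityReal c.re)
      (fun z => shiftDensityReal c.im z * (2 * c.im * z - c.im ^ 2)),
    integral_shiftDensityReal_mul_log, integral_shiftDensityReal_mul_log,
    integral_shiftDensityReal, integral_shiftDensityReal]
  ring

/-- The Cameron–Martin change of variables, obtained separately in the real and imaginary
coordinates. -/
lemma lintegral_add_stdComplexGaussian (c : ℂ) {f : ℂ → ENNReal} (hf : Measurable f) :
    ∫⁻ n, f (c + n) ∂stdComplexGaussian =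
      ∫⁻ n, ENNReal.ofReal (shiftDensity c n) * f n ∂stdComplexGaussian := by
  set γ := gaussianReal 0 (1 / 2) with hγ
  have hreal : ∀ a : ℝ, γ.map (a + ·) =
      γ.withDensity fun z => ENNReal.ofReal (shiftDensityReal a z) := fun a => by
    rw [gaussianReal_map_const_add, zero_add, gaussianReal_half_eq_withDensity]
  have hfm : Measurable fun p : ℝ × ℝ => f ⟨p.1, p.2⟩ := hf.comp measurable_complex_mk
  have h1 : ∫⁻ n, f (c + n) ∂stdComplexGaussian =
      ∫⁻ p : ℝ × ℝ, f ⟨c.re + p.1, c.im + p.2⟩ ∂(γ.prod γ) := by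
    rw [stdComplexGaussian, lintegral_map (by fun_prop) measurable_complex_mk]
    rfl
  have h2 : (γ.prod γ).map (Prod.map (c.re + ·) (c.im + ·)) =
      (γ.prod γ).withDensity fun p => ENNReal.ofReal (shiftDensityReal c.re p.1) *
        ENNReal.ofReal (shiftDensityReal c.im p.2) := by
    rw [← Measure.map_prod_map _ _ (by fun_prop) (by fun_prop), hreal, hreal,
      prod_withDensity (by fun_prop) (by fun_prop)]
  have h3 : ∫⁻ p : ℝ × ℝ, f ⟨c.re + p.1, c.im + p.2⟩ ∂(γ.prod γ) =
      ∫⁻ p : ℝ × ℝ, f ⟨p.1, p.2⟩ ∂((γ.prod γ).map (Prod.map (c.re + ·) (c.im + ·))) := by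
    rw [lintegral_map hfm (by fun_prop)]
    rfl
  rw [h1, h3, h2, lintegral_withDensity_eq_lintegral_mul _ (by fun_prop) hfm, stdComplexGaussian,
    lintegral_map (by fun_prop) measurable_complex_mk]
  refine lintegral_congr fun p => ?_
  rw [Pi.mul_apply, shiftDensity, ENNReal.ofReal_mul (shiftDensityReal_pos _ _).le]

end ShiftDensity

/-! ### Mutual information as an entropy of the output density. -/

section MutualInfo

/-- The unnormalised output density of the channel with respect to the noise. -/
def outputDensity (C : Finset ℂ) (r : ℝ) (n : ℂ) : ℝ := ∑ x ∈ C, shiftDensity (r * x) n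

lemma outputDensity_pos {C : Finset ℂ} (hC : C.Nonempty) (r : ℝ) (n : ℂ) :
    0 < outputDensity C r n := Finset.sum_pos (fun _ _ => shiftDensity_pos _ _) hC

@[fun_prop]
lemma measurable_outputDensity (C : Finset ℂ) (r : ℝ) : Measurable (outputDensity C r) := by
  unfold outputDensity; fun_prop

lemma integrable_outputDensity (C : Finset ℂ) (r : ℝ) :
    Integrable (outputDensity C r) stdComplexGaussian :=
  integrable_finsetSum _ fun _ _ => integrable_shiftDensity _

lemma integral_outputDensity (C : Finset ℂ) (r : ℝ) :
    ∫ n, outputDensity C r n ∂stdComplexGaussian = C.card := by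
  unfold outputDensity
  rw [integral_finsetSum _ fun _ _ => integrable_shiftDensity _]
  simp [integral_shiftDensity]

lemma lintegral_uniformOn_finset (C : Finset ℂ) (f : ℂ → ENNReal) :
    ∫⁻ x, f x ∂(uniformOn (C : Set ℂ)) = (C.card : ENNReal)⁻¹ * ∑ x ∈ C, f x := by
  rw [uniformOn_coe_finset, lintegral_smul_measure, lintegral_finsetSum_measure]
  simp [lintegral_dirac]

lemma channelJoint_eq_withDensity {C : Finset ℂ} (hC : C.Nonempty) (γ : ℝ) :
    channelJoint (uniformOn (C : Set ℂ)) γ =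
      ((uniformOn (C : Set ℂ)).prod stdComplexGaussian).withDensity
        fun p => ENNReal.ofReal (shiftDensity (√γ * p.1) p.2) := by
  have : IsProbabilityMeasure (uniformOn (C : Set ℂ)) :=
    isProbabilityMeasure_uniformOn C.finite_toSet hC
  have hm : Measurable fun p : ℂ × ℂ => ENNReal.ofReal (shiftDensity (√γ * p.1) p.2) :=
    (measurable_uncurry_shiftDensity.comp (by fun_prop :
      Measurable fun p : ℂ × ℂ => ((√γ : ℂ) * p.1, p.2))).ennreal_ofReal
  refine Measure.ext_of_lintegral _ fun f hf => ?_
  rw [channelJoint, lintegral_map hf (by fun_prop), lintegral_prod _ (by fun_prop),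
    lintegral_withDensity_eq_lintegral_mul _ hm hf, lintegral_prod _ (hm.mul hf).aemeasurable]
  refine lintegral_congr fun x => ?_
  exact lintegral_add_stdComplexGaussian (√γ * x) (f := fun n => f (x, n))
    (hf.comp measurable_prodMk_left)

lemma map_snd_channelJoint {C : Finset ℂ} (hC : C.Nonempty) (γ : ℝ) :
    (channelJoint (uniformOn (C : Set ℂ)) γ).map Prod.snd = stdComplexGaussian.withDensity
      fun n => ENNReal.ofReal ((C.card : ℝ)⁻¹ * outputDensity C √γ n) := by
  have : IsProbabilityMeasure (uniformOn (C : Set ℂ)) :=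
    isProbabilityMeasure_uniformOn C.finite_toSet hC
  refine Measure.ext_of_lintegral _ fun f hf => ?_
  rw [lintegral_map hf measurable_snd, channelJoint, lintegral_map (by fun_prop) (by fun_prop),
    lintegral_prod _ (by fun_prop), lintegral_uniformOn_finset,
    lintegral_withDensity_eq_lintegral_mul _ (by fun_prop) hf]
  simp only [lintegral_add_stdComplexGaussian _ hf]
  rw [← lintegral_finsetSum _ fun x _ => by fun_prop, ← lintegral_const_mul _ (by fun_prop)]
  refine lintegral_congr fun n => ?_
  have hc : (0 : ℝ) < C.card := by exact_mod_cast hC.card_pos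
  rw [Pi.mul_apply, ENNReal.ofReal_mul (by positivity), ENNReal.ofReal_inv_of_pos hc,
    ENNReal.ofReal_natCast, outputDensity,
    ENNReal.ofReal_sum_of_nonneg fun x _ => (shiftDensity_pos _ _).le, mul_assoc, Finset.sum_mul]

lemma map_fst_channelJoint {C : Finset ℂ} (hC : C.Nonempty) (γ : ℝ) :
    (channelJoint (uniformOn (C : Set ℂ)) γ).map Prod.fst = uniformOn (C : Set ℂ) := by
  have : IsProbabilityMeasure (uniformOn (C : Set ℂ)) :=
    isProbabilityMeasure_uniformOn C.finite_toSet hC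
  rw [channelJoint, Measure.map_map measurable_fst (by fun_prop)]
  exact measurePreserving_fst.map_eq

lemma uniformOn_prod {C : Finset ℂ} (hC : C.Nonempty) (μ : Measure ℂ) [SFinite μ] :
    (uniformOn (C : Set ℂ)).prod μ =
      (C.card : ENNReal)⁻¹ • ∑ x ∈ C, μ.map (Prod.mk x) := by
  have : IsProbabilityMeasure (uniformOn (C : Set ℂ)) :=
    isProbabilityMeasure_uniformOn C.finite_toSet hC
  refine Measure.ext_of_lintegral _ fun f hf => ?_
  rw [lintegral_prod _ hf.aemeasurable, lintegral_uniformOn_finset, lintegral_smul_measure,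
    lintegral_finsetSum_measure, smul_eq_mul]
  congr 1
  refine Finset.sum_congr rfl fun x _ => ?_
  rw [lintegral_map hf (by fun_prop)]

/-- The information density times the density of the joint law with respect to `U × noise`. -/
def weightedInfoDensity (C : Finset ℂ) (r : ℝ) (x n : ℂ) : ℝ :=
  shiftDensity (r * x) n *
    (Real.log (shiftDensity (r * x) n) - Real.log ((C.card : ℝ)⁻¹ * outputDensity C r n))

lemma measurable_uncurry_shiftDensity_mul (r : ℝ) :
    Measurable fun p : ℂ × ℂ => shiftDensity (r * p.1) p.2 :=
  measurable_uncurry_shiftDensity.comp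
    (by fun_prop : Measurable fun p : ℂ × ℂ => ((r : ℂ) * p.1, p.2))

lemma measurable_weightedInfoDensity (C : Finset ℂ) (r : ℝ) :
    Measurable fun p : ℂ × ℂ => weightedInfoDensity C r p.1 p.2 := by
  have := measurable_uncurry_shiftDensity_mul r
  unfold weightedInfoDensity
  fun_prop

/-- Both the joint law and the product of its marginals have explicit positive densities with
respect to input law times noise, so the Radon–Nikodym derivative is their quotient. -/
lemma llr_channelJoint {C : Finset ℂ} (hC : C.Nonempty) (γ : ℝ) :
    channelJoint (uniformOn (C : Set ℂ)) γ ≪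
      ((channelJoint (uniformOn (C : Set ℂ)) γ).map Prod.fst).prod
        ((channelJoint (uniformOn (C : Set ℂ)) γ).map Prod.snd) ∧
    llr (channelJoint (uniformOn (C : Set ℂ)) γ)
      (((channelJoint (uniformOn (C : Set ℂ)) γ).map Prod.fst).prod
        ((channelJoint (uniformOn (C : Set ℂ)) γ).map Prod.snd))
      =ᵐ[channelJoint (uniformOn (C : Set ℂ)) γ] fun p =>
      Real.log (shiftDensity (√γ * p.1) p.2) -
        Real.log ((C.card : ℝ)⁻¹ * outputDensity C √γ p.2) := by
  have : IsProbabilityMeasure (uniformOn (C : Set ℂ)) :=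
    isProbabilityMeasure_uniformOn C.finite_toSet hC
  have hgp : ∀ n, 0 < (C.card : ℝ)⁻¹ * outputDensity C √γ n := fun n =>
    mul_pos (inv_pos.2 (by exact_mod_cast hC.card_pos)) (outputDensity_pos hC _ n)
  have hρm := measurable_uncurry_shiftDensity_mul √γ
  have hgm : Measurable fun p : ℂ × ℂ => (C.card : ℝ)⁻¹ * outputDensity C √γ p.2 := by fun_prop
  have hratio : Measurable fun p : ℂ × ℂ => ENNReal.ofReal
      (shiftDensity (√γ * p.1) p.2 / ((C.card : ℝ)⁻¹ * outputDensity C √γ p.2)) :=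
    (hρm.div hgm).ennreal_ofReal
  have hprob : IsProbabilityMeasure (channelJoint (uniformOn (C : Set ℂ)) γ) :=
    Measure.isProbabilityMeasure_map
      (by fun_prop : Measurable (fun p : ℂ × ℂ => (p.1, (√γ : ℂ) * p.1 + p.2))).aemeasurable
  have hQd : ((channelJoint (uniformOn (C : Set ℂ)) γ).map Prod.fst).prod
      ((channelJoint (uniformOn (C : Set ℂ)) γ).map Prod.snd) =
      ((uniformOn (C : Set ℂ)).prod stdComplexGaussian).withDensity
        fun p => ENNReal.ofReal ((C.card : ℝ)⁻¹ * outputDensity C √γ p.2) := by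
    rw [map_fst_channelJoint hC, map_snd_channelJoint hC, prod_withDensity_right (by fun_prop)]
  have hprob2 : IsProbabilityMeasure (((channelJoint (uniformOn (C : Set ℂ)) γ).map Prod.fst).prod
      ((channelJoint (uniformOn (C : Set ℂ)) γ).map Prod.snd)) := by
    have : IsProbabilityMeasure ((channelJoint (uniformOn (C : Set ℂ)) γ).map Prod.fst) :=
      Measure.isProbabilityMeasure_map measurable_fst.aemeasurable
    have : IsProbabilityMeasure ((channelJoint (uniformOn (C : Set ℂ)) γ).map Prod.snd) :=
      Measure.isProbabilityMeasure_map measurable_snd.aemeasurable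
    infer_instance
  -- The product of marginals mentions the joint law itself; making it opaque keeps `rw [hJQ]` from
  -- rewriting inside it.
  generalize ((channelJoint (uniformOn (C : Set ℂ)) γ).map Prod.fst).prod
    ((channelJoint (uniformOn (C : Set ℂ)) γ).map Prod.snd) = Q at *
  have hJQ : channelJoint (uniformOn (C : Set ℂ)) γ = Q.withDensity fun p => ENNReal.ofReal
      (shiftDensity (√γ * p.1) p.2 / ((C.card : ℝ)⁻¹ * outputDensity C √γ p.2)) := by
    rw [hQd, ← withDensity_mul _ hgm.ennreal_ofReal hratio, channelJoint_eq_withDensity hC]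
    congr 1 with p
    rw [Pi.mul_apply, ← ENNReal.ofReal_mul (hgp _).le, mul_div_cancel₀ _ (hgp _).ne']
  rw [hJQ]
  have hac := withDensity_absolutelyContinuous Q fun p => ENNReal.ofReal
      (shiftDensity (√γ * p.1) p.2 / ((C.card : ℝ)⁻¹ * outputDensity C √γ p.2))
  refine ⟨hac, ?_⟩
  filter_upwards [hac.ae_le (Measure.rnDeriv_withDensity Q hratio)] with p hp
  rw [llr, hp, ENNReal.toReal_ofReal (div_nonneg (shiftDensity_pos _ _).le (hgp _).le),
    Real.log_div (shiftDensity_pos _ _).ne' (hgp _).ne']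

lemma inputOutputInfo_eq_sum {C : Finset ℂ} (hC : C.Nonempty) (γ : ℝ) :
    (∀ x ∈ C, Integrable (weightedInfoDensity C √γ x) stdComplexGaussian) ∧
    inputOutputInfo C γ = (C.card : ℝ)⁻¹ *
      ∑ x ∈ C, ∫ n, weightedInfoDensity C √γ x n ∂stdComplexGaussian := by
  have : IsProbabilityMeasure (uniformOn (C : Set ℂ)) :=
    isProbabilityMeasure_uniformOn C.finite_toSet hC
  obtain ⟨hac, hllr⟩ := llr_channelJoint hC γ
  have hprob : IsProbabilityMeasure (channelJoint (uniformOn (C : Set ℂ)) γ) :=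
    Measure.isProbabilityMeasure_map
      (by fun_prop : Measurable (fun p : ℂ × ℂ => (p.1, (√γ : ℂ) * p.1 + p.2))).aemeasurable
  have : IsProbabilityMeasure ((channelJoint (uniformOn (C : Set ℂ)) γ).map Prod.fst) :=
    Measure.isProbabilityMeasure_map measurable_fst.aemeasurable
  have : IsProbabilityMeasure ((channelJoint (uniformOn (C : Set ℂ)) γ).map Prod.snd) :=
    Measure.isProbabilityMeasure_map measurable_snd.aemeasurable
  have hρm := (measurable_uncurry_shiftDensity_mul √γ).ennreal_ofReal
  have hint := (integrable_congr hllr).1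
    (klDiv_ne_top_iff.1 (mutualInfo_channelJoint_ne_top C γ)).2
  have hI : inputOutputInfo C γ = ∫ p, (Real.log (shiftDensity (√γ * p.1) p.2) -
      Real.log ((C.card : ℝ)⁻¹ * outputDensity C √γ p.2))
      ∂(channelJoint (uniformOn (C : Set ℂ)) γ) := by
    rw [inputOutputInfo, mutualInfo, toReal_klDiv_of_measure_eq hac (by simp)]
    exact integral_congr_ae hllr
  rw [channelJoint_eq_withDensity hC, integrable_withDensity_iff_integrable_smul'
    hρm (Filter.Eventually.of_forall fun p => ENNReal.ofReal_lt_top)] at hint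
  rw [channelJoint_eq_withDensity hC, integral_withDensity_eq_integral_toReal_smul
    hρm (Filter.Eventually.of_forall fun p => ENNReal.ofReal_lt_top)] at hI
  simp only [ENNReal.toReal_ofReal (shiftDensity_pos _ _).le, smul_eq_mul] at hint hI
  have hF := (measurable_weightedInfoDensity C √γ).aestronglyMeasurable
    (μ := (uniformOn (C : Set ℂ)).prod stdComplexGaussian)
  change Integrable (fun p : ℂ × ℂ => weightedInfoDensity C √γ p.1 p.2) _ at hint
  change _ = ∫ p : ℂ × ℂ, weightedInfoDensity C √γ p.1 p.2 ∂_ at hI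
  have hcN : (C.card : ENNReal)⁻¹ ≠ 0 := by simp
  have hcT : (C.card : ENNReal)⁻¹ ≠ ⊤ := by simpa using hC.ne_empty
  rw [uniformOn_prod hC, integrable_smul_measure hcN hcT, integrable_finsetSum_measure] at hint
  rw [uniformOn_prod hC, integral_smul_measure, integral_finsetSum_measure hint] at hI
  refine ⟨fun x hx => (integrable_map_measure
    (measurable_weightedInfoDensity C √γ).aestronglyMeasurable
    measurable_prodMk_left.aemeasurable).1 (hint x hx), ?_⟩
  rw [hI, ENNReal.toReal_inv, ENNReal.toReal_natCast, smul_eq_mul]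
  congr 1
  refine Finset.sum_congr rfl fun x _ => ?_
  rw [integral_map measurable_prodMk_left.aemeasurable
    (measurable_weightedInfoDensity C √γ).aestronglyMeasurable]

/-- The logarithm of the quotient is split: the numerator gives the relative entropies `γ ‖x‖²` of
the shifts, the denominator the entropy of the mixture. Integrability of the mixed terms follows
from that of the information density and of the shift terms, so no separate bound on the mixture is
needed. -/
theorem inputOutputInfo_eq {C : Finset ℂ} (hC : C.Nonempty) {γ : ℝ} (hγ : 0 ≤ γ) :
    inputOutputInfo C γ = (C.card : ℝ)⁻¹ * (γ * ∑ x ∈ C, ‖x‖ ^ 2) -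
      (C.card : ℝ)⁻¹ * (∫ n, outputDensity C √γ n * Real.log (outputDensity C √γ n)
        ∂stdComplexGaussian) + Real.log C.card := by
  obtain ⟨hsec, hI⟩ := inputOutputInfo_eq_sum hC γ
  have hc : (0 : ℝ) < C.card := by exact_mod_cast hC.card_pos
  have hpos := outputDensity_pos hC √γ
  have hlogS : ∀ x ∈ C, Integrable (fun n => shiftDensity (√γ * x) n *
      Real.log ((C.card : ℝ)⁻¹ * outputDensity C √γ n)) stdComplexGaussian := by
    intro x hx
    refine ((integrable_shiftDensity_mul_log (√γ * x)).sub (hsec x hx)).congr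
      (Filter.Eventually.of_forall fun n => ?_)
    simp only [Pi.sub_apply, weightedInfoDensity]
    ring
  have hsecI : ∀ x ∈ C, ∫ n, weightedInfoDensity C √γ x n ∂stdComplexGaussian =
      γ * ‖x‖ ^ 2 - ∫ n, shiftDensity (√γ * x) n *
        Real.log ((C.card : ℝ)⁻¹ * outputDensity C √γ n) ∂stdComplexGaussian := by
    intro x hx
    simp only [weightedInfoDensity, mul_sub]
    rw [integral_sub (integrable_shiftDensity_mul_log (√γ * x)) (hlogS x hx),
      integral_shiftDensity_mul_log]
    congr 1
    rw [Complex.sq_norm, Complex.normSq_apply]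
    simp only [Complex.mul_re, Complex.mul_im, Complex.ofReal_re, Complex.ofReal_im]
    linear_combination (x.re ^ 2 + x.im ^ 2) * Real.sq_sqrt hγ
  have hSl : ∑ x ∈ C, ∫ n, shiftDensity (√γ * x) n *
      Real.log ((C.card : ℝ)⁻¹ * outputDensity C √γ n) ∂stdComplexGaussian =
      (∫ n, outputDensity C √γ n * Real.log (outputDensity C √γ n) ∂stdComplexGaussian) -
        C.card * Real.log C.card := by
    have hsplit : ∀ n, ∑ x ∈ C, shiftDensity (√γ * x) n *
        Real.log ((C.card : ℝ)⁻¹ * outputDensity C √γ n) =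
        outputDensity C √γ n * Real.log (outputDensity C √γ n) -
          outputDensity C √γ n * Real.log C.card := fun n => by
      rw [← Finset.sum_mul, Real.log_mul (inv_pos.2 hc).ne' (hpos n).ne', Real.log_inv]
      change outputDensity C √γ n * _ = _
      ring
    have hSi := (integrable_outputDensity C √γ).mul_const (Real.log C.card)
    have i1 : Integrable (fun n => outputDensity C √γ n * Real.log (outputDensity C √γ n))
        stdComplexGaussian := by
      refine ((integrable_finsetSum _ hlogS).add hSi).congr
        (Filter.Eventually.of_forall fun n => ?_)
      simp only [Pi.add_apply]
      rw [hsplit]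
      ring
    rw [← integral_finsetSum _ hlogS]
    simp only [hsplit]
    rw [integral_sub i1 hSi, integral_mul_const, integral_outputDensity]
  rw [hI, Finset.sum_congr rfl hsecI, Finset.sum_sub_distrib, hSl, ← Finset.mul_sum]
  field_simp
  ring

end MutualInfo

/-! ### Reduction of PAM and square QAM to one real dimension. -/

section Constellations

/-- The points of `M`-PAM with spacing `d`, on the real line. -/
def pamPoint (M : ℕ) (d : ℝ) (k : ℕ) : ℝ := (k - ((M : ℝ) - 1) / 2) * d

lemma pamPoint_injective (M : ℕ) {d : ℝ} (hd : 0 < d) : Function.Injective (pamPoint M d) := by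
  intro k l h
  have := mul_right_cancel₀ hd.ne' h
  exact_mod_cast sub_left_injective this

lemma pam_eq (M : ℕ) (d : ℝ) :
    pam M d = (Finset.range M).image fun k => ((pamPoint M d k : ℝ) : ℂ) := rfl

lemma sum_pam (M : ℕ) {d : ℝ} (hd : 0 < d) (f : ℂ → ℝ) :
    ∑ x ∈ pam M d, f x = ∑ k ∈ Finset.range M, f (pamPoint M d k) := by
  rw [pam_eq, Finset.sum_image fun k _ l _ h => pamPoint_injective M hd (by exact_mod_cast h)]

lemma sum_squareQAM (M : ℕ) {d : ℝ} (hd : 0 < d) (f : ℂ → ℝ) :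
    ∑ x ∈ squareQAM M d, f x = ∑ k ∈ Finset.range M, ∑ l ∈ Finset.range M,
      f ⟨pamPoint M d k, pamPoint M d l⟩ := by
  have hre : ∀ z ∈ pam M d, z.im = 0 := by
    intro z hz
    rw [pam_eq, Finset.mem_image] at hz
    obtain ⟨k, -, rfl⟩ := hz
    simp
  rw [squareQAM, Finset.sum_image, Finset.sum_product]
  · rw [sum_pam M hd]
    refine Finset.sum_congr rfl fun k _ => ?_
    rw [sum_pam M hd]
    refine Finset.sum_congr rfl fun l _ => ?_
    congr 1
    apply Complex.ext <;> simp
  · rintro ⟨a, b⟩ hab ⟨a', b'⟩ hab' h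
    simp only [Finset.coe_product, Set.mem_prod, Finset.mem_coe] at hab hab'
    have h1 := congrArg Complex.re h
    have h2 := congrArg Complex.im h
    simp [hre a hab.1, hre b hab.2, hre a' hab'.1, hre b' hab'.2] at h1 h2
    refine Prod.ext (Complex.ext h1 ?_) (Complex.ext h2 ?_)
    · rw [hre a hab.1, hre a' hab'.1]
    · rw [hre b hab.2, hre b' hab'.2]

lemma card_pam (M : ℕ) {d : ℝ} (hd : 0 < d) : ((pam M d).card : ℝ) = M := by
  have := sum_pam M hd fun _ => 1
  simpa using this

lemma card_squareQAM (M : ℕ) {d : ℝ} (hd : 0 < d) : ((squareQAM M d).card : ℝ) = M * M := by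
  have := sum_squareQAM M hd fun _ => 1
  simpa using this

lemma sum_shiftDensityReal_pam (M : ℕ) (d r z : ℝ) :
    ∑ k ∈ Finset.range M, shiftDensityReal (r * pamPoint M d k) z =
      expMoment (Finset.range M) (pamPoint M d) 0 (2 * r ^ 2) (2 * r * z) := by
  unfold expMoment shiftDensityReal
  refine Finset.sum_congr rfl fun k _ => ?_
  rw [pow_zero, one_mul]
  congr 1
  ring

lemma outputDensity_pam (M : ℕ) {d : ℝ} (hd : 0 < d) (r : ℝ) (n : ℂ) :
    outputDensity (pam M d) r n =
      expMoment (Finset.range M) (pamPoint M d) 0 (2 * r ^ 2) (2 * r * n.re) := by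
  rw [outputDensity, sum_pam M hd, ← sum_shiftDensityReal_pam]
  refine Finset.sum_congr rfl fun k _ => ?_
  simp [shiftDensity, shiftDensityReal]

lemma outputDensity_squareQAM (M : ℕ) {d : ℝ} (hd : 0 < d) (r : ℝ) (n : ℂ) :
    outputDensity (squareQAM M d) r n =
      expMoment (Finset.range M) (pamPoint M d) 0 (2 * r ^ 2) (2 * r * n.re) *
      expMoment (Finset.range M) (pamPoint M d) 0 (2 * r ^ 2) (2 * r * n.im) := by
  rw [outputDensity, sum_squareQAM M hd, ← sum_shiftDensityReal_pam, ← sum_shiftDensityReal_pam,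
    Finset.sum_mul_sum]
  refine Finset.sum_congr rfl fun k _ => Finset.sum_congr rfl fun l _ => ?_
  simp [shiftDensity]

/-- Both arguments are centred Gaussians of variance `2γ`. -/
lemma integral_gaussianReal_half_eq {f : ℝ → ℝ} (hf : Measurable f) {γ : ℝ} (hγ : 0 ≤ γ) :
    ∫ z, f (2 * √γ * z) ∂(gaussianReal 0 (1 / 2)) =
      ∫ z, f (√(2 * γ) * z) ∂(gaussianReal 0 1) := by
  have h1 : (gaussianReal 0 (1 / 2)).map (2 * √γ * ·) =
      (gaussianReal 0 1).map (√(2 * γ) * ·) := by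
    rw [gaussianReal_map_const_mul, gaussianReal_map_const_mul]
    congr 1
    · simp
    · ext
      push_cast
      simp only [mul_pow]
      rw [Real.sq_sqrt hγ, Real.sq_sqrt (by linarith)]
      ring
  have h2 := integral_map (μ := gaussianReal 0 (1 / 2)) (φ := (2 * √γ * ·))
    (by fun_prop) (f := f) hf.aestronglyMeasurable
  have h3 := integral_map (μ := gaussianReal 0 1) (φ := (√(2 * γ) * ·))
    (by fun_prop) (f := f) hf.aestronglyMeasurable
  rw [← h2, h1, h3]

section Entropy

variable {ι : Type*} {t : Finset ι} {x : ι → ℝ}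

lemma exists_abs_mul_log_expMoment_le (ht : t.Nonempty) (x : ι → ℝ) (B : ℝ) :
    ∃ C D, 0 ≤ C ∧ 0 ≤ D ∧ ∀ s, 0 ≤ s → s ≤ B → ∀ w,
      |expMoment t x 0 s w * Real.log (expMoment t x 0 s w)| ≤ C * Real.exp (D * |w|) := by
  obtain ⟨A, hA1, hA⟩ := exists_abs_le_of_finset t x
  refine ⟨|A ^ 2 * t.card * (Real.log t.card + A + B * A ^ 2 / 2 + 1)|, A + 1, abs_nonneg _,
    by linarith, fun s hs hsB w => ?_⟩
  have k0 := abs_expMoment_le_exp t x hA1 hA (p := 0) (by norm_num) hs hsB ht w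
  rw [abs_mul]
  refine le_trans ?_ (k0.trans (mul_le_mul_of_nonneg_right (le_abs_self _) (Real.exp_pos _).le))
  gcongr
  linarith

lemma continuous_mul_log_expMoment (ht : t.Nonempty) (x : ι → ℝ) :
    Continuous fun q : ℝ × ℝ => expMoment t x 0 q.1 q.2 * Real.log (expMoment t x 0 q.1 q.2) :=
  (continuous_expMoment t x 0).mul
    ((continuous_expMoment t x 0).log fun _ => (expMoment_zero_pos ht _ _).ne')

/-- The derivative formula needs `s > 0`; continuity up to `s = 0` is what allows a minimal
threshold at `ζ = 0`. -/
lemma continuousOn_gaussianEntropy (ht : t.Nonempty) (x : ι → ℝ) :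
    ContinuousOn (gaussianEntropy t x) (Set.Ici 0) := by
  have hc := continuous_mul_log_expMoment ht x
  have hIcc : ∀ B, ContinuousOn (gaussianEntropy t x) (Set.Icc 0 B) := by
    intro B
    obtain ⟨C, D, hC, hD, h⟩ := exists_abs_mul_log_expMoment_le ht x B
    refine continuousOn_of_dominated (bound := fun z => C * Real.exp ((D * √B) * |z|)) ?_ ?_ ?_ ?_
    · intro s _
      exact (hc.comp (by fun_prop : Continuous fun z => (s, √s * z))).aestronglyMeasurable
    · intro s hs
      refine Filter.Eventually.of_forall fun z => ?_
      refine (h s hs.1 hs.2 _).trans ?_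
      rw [abs_mul, abs_of_nonneg (Real.sqrt_nonneg s), mul_assoc]
      have := Real.sqrt_le_sqrt hs.2
      gcongr
    · exact (integrable_exp_mul_abs_gaussianReal 0 1 _).const_mul _
    · refine Filter.Eventually.of_forall fun z => ?_
      exact (hc.comp (by fun_prop : Continuous fun s => (s, √s * z))).continuousOn
  intro s hs
  refine ((hIcc (s + 1)) s ⟨hs, by linarith⟩).mono_of_mem_nhdsWithin ?_
  rw [← Set.Ici_inter_Iic]
  exact Filter.inter_mem self_mem_nhdsWithin (nhdsWithin_le_nhds (Iic_mem_nhds (by linarith)))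

end Entropy

theorem inputOutputInfo_pam {M : ℕ} (hM : 0 < M) {d : ℝ} (hd : 0 < d) {γ : ℝ} (hγ : 0 ≤ γ) :
    inputOutputInfo (pam M d) γ = (M : ℝ)⁻¹ * (γ * ∑ k ∈ Finset.range M, pamPoint M d k ^ 2 -
      gaussianEntropy (Finset.range M) (pamPoint M d) (2 * γ)) + Real.log M := by
  have ht : (Finset.range M).Nonempty := ⟨0, by simpa using hM⟩
  have hC : (pam M d).Nonempty := ht.image _
  have hc := continuous_mul_log_expMoment ht (pamPoint M d)
  set f : ℝ → ℝ := fun w => expMoment (Finset.range M) (pamPoint M d) 0 (2 * γ) w *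
    Real.log (expMoment (Finset.range M) (pamPoint M d) 0 (2 * γ) w) with hf
  have hfc : Continuous f := hc.comp (by fun_prop : Continuous fun w : ℝ => (2 * γ, w))
  have hent : gaussianEntropy (Finset.range M) (pamPoint M d) (2 * γ) =
      ∫ z, f (√(2 * γ) * z) ∂(gaussianReal 0 1) := rfl
  rw [inputOutputInfo_eq hC hγ, sum_pam M hd, card_pam M hd]
  simp only [outputDensity_pam M hd, Real.sq_sqrt hγ]
  have hint : ∫ n : ℂ, f (2 * √γ * n.re) ∂stdComplexGaussian =
      ∫ z, f (√(2 * γ) * z) ∂(gaussianReal 0 1) := by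
    have hfm := hfc.measurable
    rw [integral_stdComplexGaussian (f := fun n => f (2 * √γ * n.re)) (by fun_prop),
      ← integral_gaussianReal_half_eq hfc.measurable hγ]
    have := integral_prod_mul (μ := gaussianReal 0 (1 / 2)) (ν := gaussianReal 0 (1 / 2))
      (fun z => f (2 * √γ * z)) (fun _ => (1 : ℝ))
    simpa using this
  change _ - _ * (∫ n : ℂ, f (2 * √γ * n.re) ∂stdComplexGaussian) + _ = _
  rw [hint, ← hent]
  simp only [Complex.norm_real, Real.norm_eq_abs, sq_abs]
  ring

theorem inputOutputInfo_squareQAM {M : ℕ} (hM : 0 < M) {d : ℝ} (hd : 0 < d) {γ : ℝ} (hγ : 0 ≤ γ) :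
    inputOutputInfo (squareQAM M d) γ =
      2 * (M : ℝ)⁻¹ * (γ * ∑ k ∈ Finset.range M, pamPoint M d k ^ 2 -
      gaussianEntropy (Finset.range M) (pamPoint M d) (2 * γ)) + 2 * Real.log M := by
  have ht : (Finset.range M).Nonempty := ⟨0, by simpa using hM⟩
  have hC : (squareQAM M d).Nonempty := by
    have : (pam M d).Nonempty := ht.image _
    exact (this.product this).image _
  have hM0 : (0 : ℝ) < M := by exact_mod_cast hM
  have hc := continuous_mul_log_expMoment ht (pamPoint M d)
  set g : ℝ → ℝ := expMoment (Finset.range M) (pamPoint M d) 0 (2 * γ) with hg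
  have hgc : Continuous g := continuous_expMoment_right _ _ _ _
  have hgp : ∀ w, 0 < g w := expMoment_zero_pos ht _
  set f : ℝ → ℝ := fun w => g w * Real.log (g w) with hf
  have hfc : Continuous f := hc.comp (by fun_prop : Continuous fun w : ℝ => (2 * γ, w))
  have hent : gaussianEntropy (Finset.range M) (pamPoint M d) (2 * γ) =
      ∫ z, f (√(2 * γ) * z) ∂(gaussianReal 0 1) := rfl
  have hgI : ∫ z, g (2 * √γ * z) ∂(gaussianReal 0 (1 / 2)) = M := by
    rw [integral_gaussianReal_half_eq hgc.measurable hγ,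
      (integral_expMoment_sqrt _ _ 0 (by linarith)).2]
    simp
  have hgi : Integrable (fun z => g (2 * √γ * z)) (gaussianReal 0 (1 / 2)) := by
    -- A non-integrable function would have integral 0, whereas the integral is `M > 0`.
    by_contra hcon
    rw [integral_undef hcon] at hgI
    exact hM0.ne hgI
  have hfi : Integrable (fun z => f (2 * √γ * z)) (gaussianReal 0 (1 / 2)) := by
    obtain ⟨C, D, hC, hD, h⟩ := exists_abs_mul_log_expMoment_le ht (pamPoint M d) (2 * γ)
    refine integrable_gaussianReal_of_abs_le (C := C) (D := D * (2 * √γ)) (by fun_prop) fun z => ?_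
    refine (h (2 * γ) (by linarith) le_rfl _).trans (le_of_eq ?_)
    rw [abs_mul, abs_of_nonneg (by positivity : 0 ≤ 2 * √γ), mul_assoc D]
  have hfI := integral_gaussianReal_half_eq hfc.measurable hγ
  rw [← hent] at hfI
  rw [inputOutputInfo_eq hC hγ, sum_squareQAM M hd, card_squareQAM M hd]
  simp only [outputDensity_squareQAM M hd, Real.sq_sqrt hγ]
  have hint : ∫ n : ℂ, (g (2 * √γ * n.re) * g (2 * √γ * n.im)) *
      Real.log (g (2 * √γ * n.re) * g (2 * √γ * n.im)) ∂stdComplexGaussian =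
      2 * M * gaussianEntropy (Finset.range M) (pamPoint M d) (2 * γ) := by
    have hm := hgc.measurable
    rw [integral_stdComplexGaussian (by fun_prop)]
    have e : ∀ p : ℝ × ℝ, (g (2 * √γ * p.1) * g (2 * √γ * p.2)) *
        Real.log (g (2 * √γ * p.1) * g (2 * √γ * p.2)) =
        f (2 * √γ * p.1) * g (2 * √γ * p.2) + g (2 * √γ * p.1) * f (2 * √γ * p.2) := fun p => by
      rw [Real.log_mul (hgp _).ne' (hgp _).ne', hf]
      ring
    simp only [e]
    rw [integral_add (hfi.mul_prod hgi) (hgi.mul_prod hfi),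
      integral_prod_mul (fun z => f (2 * √γ * z)) (fun z => g (2 * √γ * z)),
      integral_prod_mul (fun z => g (2 * √γ * z)) (fun z => f (2 * √γ * z)), hfI, hgI]
    ring
  have hsum : ∑ k ∈ Finset.range M, ∑ l ∈ Finset.range M,
      ‖(⟨pamPoint M d k, pamPoint M d l⟩ : ℂ)‖ ^ 2 =
      2 * M * ∑ k ∈ Finset.range M, pamPoint M d k ^ 2 := by
    simp only [Complex.sq_norm, Complex.normSq_mk, ← sq, Finset.sum_add_distrib,
      Finset.sum_const, Finset.card_range, nsmul_eq_mul, ← Finset.mul_sum]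
    ring
  rw [hint, hsum, Real.log_mul hM0.ne' hM0.ne']
  field_simp
  ring

/-- Independent quadratures make QAM twice PAM, so one concave function of `ζ` serves both
constellations. -/
lemma exists_infoLog_eq {M : ℕ} (hM : 0 < M) {d : ℝ} (hd : 0 < d) {C : Finset ℂ}
    (hC : C = pam M d ∨ C = squareQAM M d) : ∃ κ b : ℝ, 0 ≤ κ ∧ ∀ ζ, 0 ≤ ζ → infoLog C ζ =
      κ * ((Real.exp ζ - 1) * ∑ k ∈ Finset.range M, pamPoint M d k ^ 2 -
        gaussianEntropy (Finset.range M) (pamPoint M d) (2 * (Real.exp ζ - 1))) + b := by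
  have hγ : ∀ ζ : ℝ, 0 ≤ ζ → 0 ≤ Real.exp ζ - 1 := fun ζ hζ => by
    linarith [Real.one_le_exp hζ]
  rcases hC with rfl | rfl
  · exact ⟨_, _, by positivity, fun ζ hζ => inputOutputInfo_pam hM hd (hγ ζ hζ)⟩
  · exact ⟨_, _, by positivity, fun ζ hζ => inputOutputInfo_squareQAM hM hd (hγ ζ hζ)⟩

lemma continuousOn_infoLog {M : ℕ} (hM : 0 < M) {d : ℝ} (hd : 0 < d) {C : Finset ℂ}
    (hC : C = pam M d ∨ C = squareQAM M d) : ContinuousOn (infoLog C) (Set.Ici 0) := by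
  obtain ⟨κ, b, -, h⟩ := exists_infoLog_eq hM hd hC
  have ht : (Finset.range M).Nonempty := ⟨0, by simpa using hM⟩
  have hent : ContinuousOn (fun ζ => gaussianEntropy (Finset.range M) (pamPoint M d)
      (2 * (Real.exp ζ - 1))) (Set.Ici 0) :=
    (continuousOn_gaussianEntropy ht (pamPoint M d)).comp (by fun_prop) fun ζ hζ => by
      have := Real.one_le_exp (Set.mem_Ici.1 hζ)
      exact Set.mem_Ici.2 (by linarith)
  refine ContinuousOn.congr ?_ fun ζ hζ => h ζ hζ
  fun_prop

lemma concaveOn_infoLog {M : ℕ} (hM : 0 < M) {d : ℝ} (hd : 0 < d) {C : Finset ℂ}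
    (hC : C = pam M d ∨ C = squareQAM M d) {ζ₁ : ℝ} (hζ₁ : 0 ≤ ζ₁)
    (h : 4 ≤ d ^ 2 * (Real.exp ζ₁ - 1)) : ConcaveOn ℝ (Set.Ici ζ₁) (infoLog C) := by
  obtain ⟨κ, b, hκ, heq⟩ := exists_infoLog_eq hM hd hC
  obtain ⟨m, rfl⟩ := Nat.exists_eq_succ_of_ne_zero hM.ne'
  have := ((concaveOn_sub_gaussianEntropy hd (((m.succ : ℕ) - 1 : ℝ) / 2) m h).smul hκ).add_const b
  refine this.congr fun ζ hζ => ?_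
  rw [heq ζ (hζ₁.trans hζ)]
  rfl

/-- Only this inequality is needed: a smaller minimum distance weakens both the bound on the
threshold and the claim of concavity. -/
lemma minDist_le {M : ℕ} (hM : 2 ≤ M) {d : ℝ} (hd : 0 < d) {C : Finset ℂ}
    (hC : C = pam M d ∨ C = squareQAM M d) : minDist C ≤ d := by
  have h0 : (pamPoint M d 0 : ℂ) ∈ pam M d :=
    Finset.mem_image_of_mem _ (Finset.mem_range.2 (by omega))
  have h1 : (pamPoint M d 1 : ℂ) ∈ pam M d :=
    Finset.mem_image_of_mem _ (Finset.mem_range.2 (by omega))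
  have hdiff : pamPoint M d 1 - pamPoint M d 0 = d := by
    simp only [pamPoint]; push_cast; ring
  have key : ∀ a b : ℂ, a ∈ C → b ∈ C → b - a = d → minDist C ≤ d := by
    intro a b ha hb hab
    have hne : a ≠ b := by
      rintro rfl
      rw [sub_self] at hab
      exact hd.ne (by exact_mod_cast hab)
    refine (Set.infsep_le_dist_of_mem ha hb hne).trans (le_of_eq ?_)
    rw [dist_comm, dist_eq_norm, hab, Complex.norm_real, Real.norm_eq_abs, abs_of_pos hd]
  have hc : (pamPoint M d 1 : ℂ) - pamPoint M d 0 = d := by exact_mod_cast hdiff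
  rcases hC with rfl | rfl
  · exact key _ _ h0 h1 hc
  · refine key (pamPoint M d 0 + Complex.I * pamPoint M d 0)
      (pamPoint M d 1 + Complex.I * pamPoint M d 0) ?_ ?_ (by rw [← hc]; ring)
    · exact Finset.mem_image_of_mem (fun p : ℂ × ℂ => p.1 + Complex.I * p.2)
        (Finset.mk_mem_product h0 h0)
    · exact Finset.mem_image_of_mem (fun p : ℂ × ℂ => p.1 + Complex.I * p.2)
        (Finset.mk_mem_product h1 h0)

end Constellations

/-! ### Existence of the minimal threshold. -/

section Threshold

/-- The concavity inequality for both points shifted right by `δ > 0` passes to the limit `δ → 0` by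
continuity. -/
lemma concaveOn_Ici_of_forall_gt {f : ℝ → ℝ} {a : ℝ} (hf : ContinuousOn f (Set.Ici a))
    (h : ∀ b, a < b → ConcaveOn ℝ (Set.Ici b) f) : ConcaveOn ℝ (Set.Ici a) f := by
  refine ⟨convex_Ici a, fun x hx y hy α β hα hβ hαβ => ?_⟩
  have ht : ∀ x, x ∈ Set.Ici a → Filter.Tendsto (fun δ : ℝ => f (x + δ)) (nhdsWithin 0 (Set.Ioi 0))
      (nhds (f x)) := by
    intro x hx
    refine (hf x hx).tendsto.comp (tendsto_nhdsWithin_iff.2 ⟨?_, ?_⟩)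
    · have : Filter.Tendsto (fun δ : ℝ => x + δ) (nhds 0) (nhds (x + 0)) :=
        (continuous_const.add continuous_id).tendsto 0
      rw [add_zero] at this
      exact this.mono_left nhdsWithin_le_nhds
    · filter_upwards [self_mem_nhdsWithin] with δ hδ
      exact Set.mem_Ici.2 (by linarith [Set.mem_Ici.1 hx, Set.mem_Ioi.1 hδ])
  have hz : α • x + β • y ∈ Set.Ici a := convex_Ici a hx hy hα hβ hαβ
  refine le_of_tendsto_of_tendsto (((ht x hx).const_smul α).add ((ht y hy).const_smul β))
    (ht _ hz) ?_
  filter_upwards [self_mem_nhdsWithin] with δ hδ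
  have hδ' : 0 < δ := hδ
  have := (h (a + δ) (by linarith)).2 (x := x + δ) (y := y + δ)
    (Set.mem_Ici.2 (by linarith [Set.mem_Ici.1 hx])) (Set.mem_Ici.2 (by linarith [Set.mem_Ici.1 hy]))
    hα hβ hαβ
  refine this.trans (le_of_eq ?_)
  congr 1
  simp only [smul_eq_mul]
  linear_combination δ * hαβ

lemma isLeast_concaveThresholds {C : Finset ℂ} (hcont : ContinuousOn (infoLog C) (Set.Ici 0))
    (hne : (concaveThresholds C).Nonempty) : IsLeast (concaveThresholds C) (zetaBar C) := by
  have hbdd : BddBelow (concaveThresholds C) := ⟨0, fun ζ hζ => hζ.1⟩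
  have h0 : 0 ≤ zetaBar C := le_csInf hne fun ζ hζ => hζ.1
  refine ⟨⟨h0, concaveOn_Ici_of_forall_gt (hcont.mono (Set.Ici_subset_Ici.2 h0)) fun b hb => ?_⟩,
    fun ζ hζ => csInf_le hbdd hζ⟩
  obtain ⟨ζ, hζ, hlt⟩ := exists_lt_of_csInf_lt hne hb
  exact hζ.2.subset (Set.Ici_subset_Ici.2 hlt.le) (convex_Ici b)

end Threshold

end

theorem theorem3 (M : ℕ) (hM : 2 ≤ M) (d : ℝ) (hd : 0 < d) (C : Finset ℂ)
    (hC : C = pam M d ∨ C = squareQAM M d) (hpower : avgPower C = 1) :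
    IsLeast (concaveThresholds C) (zetaBar C) ∧
      (minDist C / 2) ^ 2 * gammaBar C ≤ 1 ∧
      ConcaveOn ℝ {ζ : ℝ | 1 ≤ (minDist C / 2) ^ 2 * (Real.exp ζ - 1)} (infoLog C) := by
  have hM0 : 0 < M := by omega
  have hmin := minDist_le hM hd hC
  have hmin0 : 0 ≤ minDist C := Set.infsep_nonneg
  -- The log-SNR at which `(d / 2)² γ = 1`.
  set ζ₁ := Real.log (1 + 4 / d ^ 2) with hζ₁
  have hd2 : 0 < 4 / d ^ 2 := by positivity
  have hexp : Real.exp ζ₁ - 1 = 4 / d ^ 2 := by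
    rw [hζ₁, Real.exp_log (by linarith)]; ring
  have hζ₁0 : 0 ≤ ζ₁ := Real.log_nonneg (by linarith)
  have hconc : ConcaveOn ℝ (Set.Ici ζ₁) (infoLog C) := by
    refine concaveOn_infoLog hM0 hd hC hζ₁0 (le_of_eq ?_)
    rw [hexp]; field_simp
  have hmem : ζ₁ ∈ concaveThresholds C := ⟨hζ₁0, hconc⟩
  have hleast := isLeast_concaveThresholds (continuousOn_infoLog hM0 hd hC) ⟨ζ₁, hmem⟩
  refine ⟨hleast, ?_, ?_⟩
  · have h1 : gammaBar C ≤ 4 / d ^ 2 := by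
      rw [gammaBar, ← hexp]
      have := Real.exp_le_exp.2 (hleast.2 hmem)
      linarith
    calc (minDist C / 2) ^ 2 * gammaBar C ≤ (d / 2) ^ 2 * (4 / d ^ 2) := by
          have : 0 ≤ gammaBar C := by
            rw [gammaBar]; linarith [Real.one_le_exp hleast.1.1]
          gcongr
      _ = 1 := by field_simp; norm_num
  -- The set lies in `[ζ₁, ∞)` because the minimum distance is at most `d`, and it is convex because
  -- it is an upper set in `ℝ`.
  · refine hconc.subset (fun ζ hζ => ?_) (IsUpperSet.ordConnected fun a b hab ha => ?_).convex
    · have hpos : 0 < Real.exp ζ - 1 := by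
        refine pos_of_mul_pos_right (lt_of_lt_of_le one_pos (Set.mem_ofPred_eq ▸ hζ)) (sq_nonneg _)
      have h1 : 1 ≤ (d / 2) ^ 2 * (Real.exp ζ - 1) :=
        le_trans hζ (by gcongr)
      have h2 : 4 / d ^ 2 ≤ Real.exp ζ - 1 := by
        rw [div_le_iff₀ (by positivity)]; linarith
      refine Set.mem_Ici.2 ((Real.log_le_iff_le_exp (by linarith)).2 (by linarith))
    · exact le_trans (show 1 ≤ (minDist C / 2) ^ 2 * (Real.exp a - 1) from ha) (by gcongr)
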